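/- **Theorem 3.1.** Let $d,\alpha\in\mathbb N=\{1,2,\dots\}$, $1\le q<p<\infty$, $a>0$, $b\ge 0$. Functions and Banach spaces are all real, or all complex. *Pseudo $s$-numbers.* A pseudo $s$-number $s$ assigns to every bounded linear operator $T:X\to Y$ between Banach spaces a real sequence $(s_n(T))_{n\ge1}$ such that - $\|T\|=s_1(T)\ge s_2(T)\ge\dots\ge 0$; - $s_n(S+T)\le s_n(S)+\|T\|$ for all $S,T\in\mathcal L(X,Y)$, $n\ge 1$; - $s_n(BTA)\le \|B\|\,s_n(T)\,\|A\|$ for all $A\in\mathcal L(X_0,X)$, $T\in\mathcal L(X,Y)$, $B\in\mathcal L(Y,Y_0)$, $n\ge 1$. It is *additive* if $s_{n+m-1}(S+T)\le s_n(S)+s_m(T)$ for all $S,T\in\mathcal L(X,Y)$ and $n,m\ge1$. It is *weakly injective* if for every $T\in\mathcal L(X,Y)$ and every linear isometry (metric injection) $J:Y\to \tilde Y$ into a Banach space there are constants $c,C>0$, independent of $n$, with $c\,s_n(JT)\le s_n(T)\le C\,s_n(JT)$ for all $n\ge1$. *Spaces.* Let $\gamma(\mathrm dx)=(2\pi)^{-d/2}e^{-|x|^2/2}\,\mathrm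 dx$ be the standard Gaussian measure on $\mathbb R^d$. Let $W^\alpha_p(\mathbb R^d,\gamma)$ be the space of all $f\in L_p(\mathbb R^d,\gamma)$ whose weak derivatives $D^rf$ belong to $L_p(\mathbb R^d,\gamma)$ for all $r\in\mathbb N_0^d$ with $|r|_\infty=\max_i r_i\le\alpha$, with norm $$\|f\|=\Big(\sum_{|r|_\infty\le\alpha}\|D^rf\|_{L_p(\mathbb R^d,\gamma)}^p\Big)^{1/p}.$$ Let $\mathbb I^d=[-\tfrac12,\tfrac12]^d$ with Lebesgue measure. Let $\tilde L_q(\mathbb I^d)$ be the subspace of $L_q(\mathbb I^d)$ of all functions that extend to functions on $\mathbb R^d$ that are $1$-periodic in each variable. Let $\tilde W^\alpha_p(\mathbb I^d)$ be the space of all functions on $\mathbb I^d$ whose $1$-periodic extension to $\mathbb R^d$ has weak derivatives $D^rf$ on $\mathbb R^d$ for all $|r|_\infty\le\alpha$, with $D^rf|_{\mathbb I^d}\in L_p(\mathbb I^d)$, and with norm $$\|f\|=\Big(\sum_{|r|_\infty\le\alpha}\|D^rf\|_{L_p(\mathbb I^d)}^p\Big)^{1/p}.$$ Let $I:\tilde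 W^\alpha_p(\mathbb I^d)\to\tilde L_q(\mathbb I^d)$ and $I_\gamma:W^\alpha_p(\mathbb R^d,\gamma)\to L_q(\mathbb R^d,\gamma)$ be the embeddings $f\mapsto f$. *Claim.* Let $s$ be a pseudo $s$-number such that, for some constants $c,C>0$ and all sufficiently large $n$, $$c\,n^{-a}(\log n)^b\le s_n(I)\le C\,n^{-a}(\log n)^b .$$ 1. If $s$ is weakly injective, then there is a constant $c'>0$ such that $s_n(I_\gamma)\ge c'\,n^{-a}(\log n)^b$ for all sufficiently large $n$. 2. If $s$ is additive, then there is a constant $C'>0$ such that $s_n(I_\gamma)\le C'\,n^{-a}(\log n)^b$ for all sufficiently large $n$. -/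

import Mathlib

open MeasureTheory Filter Asymptotics
open scoped ENNReal

namespace MixedSobolev

/-! ### Pseudo `s`-numbers -/

/-- A pseudo `s`-number on the bounded linear operators between Banach spaces over `𝕜`
(`𝕜 = ℝ` or `ℂ`).  The sequence `s₁(T), s₂(T), …` is indexed by the integers `n ≥ 1`; the value
`num T 0` carries no information. -/
structure PseudoSNumber (𝕜 : Type) [RCLike 𝕜] where
  num : ∀ {X Y : Type} [NormedAddCommGroup X] [NormedSpace 𝕜 X] [CompleteSpace X]
    [NormedAddCommGroup Y] [NormedSpace 𝕜 Y] [CompleteSpace Y], (X →L[𝕜] Y) → ℕ → ℝ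
  num_one : ∀ {X Y : Type} [NormedAddCommGroup X] [NormedSpace 𝕜 X] [CompleteSpace X]
    [NormedAddCommGroup Y] [NormedSpace 𝕜 Y] [CompleteSpace Y] (T : X →L[𝕜] Y),
    num T 1 = ‖T‖
  num_succ_le : ∀ {X Y : Type} [NormedAddCommGroup X] [NormedSpace 𝕜 X] [CompleteSpace X]
    [NormedAddCommGroup Y] [NormedSpace 𝕜 Y] [CompleteSpace Y] (T : X →L[𝕜] Y) (n : ℕ),
    1 ≤ n → num T (n + 1) ≤ num T n
  num_nonneg : ∀ {X Y : Type} [NormedAddCommGroup X] [NormedSpace 𝕜 X] [CompleteSpace X]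
    [NormedAddCommGroup Y] [NormedSpace 𝕜 Y] [CompleteSpace Y] (T : X →L[𝕜] Y) (n : ℕ),
    1 ≤ n → 0 ≤ num T n
  num_add_le : ∀ {X Y : Type} [NormedAddCommGroup X] [NormedSpace 𝕜 X] [CompleteSpace X]
    [NormedAddCommGroup Y] [NormedSpace 𝕜 Y] [CompleteSpace Y] (S T : X →L[𝕜] Y) (n : ℕ),
    1 ≤ n → num (S + T) n ≤ num S n + ‖T‖
  num_comp_le : ∀ {X₀ X Y Y₀ : Type}
    [NormedAddCommGroup X₀] [NormedSpace 𝕜 X₀] [CompleteSpace X₀]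
    [NormedAddCommGroup X] [NormedSpace 𝕜 X] [CompleteSpace X]
    [NormedAddCommGroup Y] [NormedSpace 𝕜 Y] [CompleteSpace Y]
    [NormedAddCommGroup Y₀] [NormedSpace 𝕜 Y₀] [CompleteSpace Y₀]
    (B : Y →L[𝕜] Y₀) (T : X →L[𝕜] Y) (A : X₀ →L[𝕜] X) (n : ℕ),
    1 ≤ n → num (B.comp (T.comp A)) n ≤ ‖B‖ * num T n * ‖A‖

/-- Additivity: `s_{n+m-1}(S+T) ≤ s_n(S) + s_m(T)` for all `n, m ≥ 1`. -/
def PseudoSNumber.IsAdditive {𝕜 : Type} [RCLike 𝕜] (s : PseudoSNumber 𝕜) : Prop :=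
  ∀ {X Y : Type} [NormedAddCommGroup X] [NormedSpace 𝕜 X] [CompleteSpace X]
    [NormedAddCommGroup Y] [NormedSpace 𝕜 Y] [CompleteSpace Y] (S T : X →L[𝕜] Y) (n m : ℕ),
    1 ≤ n → 1 ≤ m → s.num (S + T) (n + m - 1) ≤ s.num S n + s.num T m

/-- Weak injectivity: `s_n(T) ≍ s_n(JT)` for every operator `T : X → Y` and every metric
injection `J : Y → Z`, with constants that do not depend on `n`. -/
def PseudoSNumber.IsWeaklyInjective {𝕜 : Type} [RCLike 𝕜] (s : PseudoSNumber 𝕜) : Prop :=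
  ∀ {X Y Z : Type} [NormedAddCommGroup X] [NormedSpace 𝕜 X] [CompleteSpace X]
    [NormedAddCommGroup Y] [NormedSpace 𝕜 Y] [CompleteSpace Y]
    [NormedAddCommGroup Z] [NormedSpace 𝕜 Z] [CompleteSpace Z]
    (T : X →L[𝕜] Y) (J : Y →ₗᵢ[𝕜] Z),
    ∃ c C : ℝ, 0 < c ∧ 0 < C ∧ ∀ n : ℕ, 1 ≤ n →
      c * s.num (J.toContinuousLinearMap.comp T) n ≤ s.num T n ∧
      s.num T n ≤ C * s.num (J.toContinuousLinearMap.comp T) n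

/-! ### Mixed weak derivatives on `ℝ^d` -/

/-- The partial derivative `∂φ/∂x_i`. -/
noncomputable def partialDeriv {d : ℕ} (i : Fin d) (φ : (Fin d → ℝ) → ℝ) : (Fin d → ℝ) → ℝ :=
  fun x => fderiv ℝ φ x (Pi.single i 1)

/-- The mixed partial derivative `D^r φ = ∂₁^{r₁} ⋯ ∂_d^{r_d} φ`. -/
noncomputable def mixedPartial {d : ℕ} (r : Fin d → ℕ) (φ : (Fin d → ℝ) → ℝ) :
    (Fin d → ℝ) → ℝ :=
  (List.finRange d).foldr (fun i ψ => (partialDeriv i)^[r i] ψ) φ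

/-- `h` is the weak (generalized) derivative `D^r f` on `ℝ^d`, tested against `C_c^∞(ℝ^d)`. -/
def IsWeakDeriv {𝕜 : Type} [RCLike 𝕜] {d : ℕ} (r : Fin d → ℕ) (f h : (Fin d → ℝ) → 𝕜) : Prop :=
  LocallyIntegrable f volume ∧ LocallyIntegrable h volume ∧
    ∀ φ : (Fin d → ℝ) → ℝ, ContDiff ℝ (⊤ : ℕ∞) φ → HasCompactSupport φ →
      ∫ x, mixedPartial r φ x • f x = (-1 : 𝕜) ^ (∑ i, r i) * ∫ x, φ x • h x

section WeakDerivFacts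

variable {𝕜 : Type} [RCLike 𝕜] {d : ℕ}

theorem partialDeriv_testFunction (i : Fin d) {φ : (Fin d → ℝ) → ℝ}
    (h : ContDiff ℝ (⊤ : ℕ∞) φ ∧ HasCompactSupport φ) :
    ContDiff ℝ (⊤ : ℕ∞) (partialDeriv i φ) ∧ HasCompactSupport (partialDeriv i φ) := by
  constructor
  · exact (h.1.fderiv_right (by simp)).clm_apply contDiff_const
  · exact h.2.fderiv_apply ℝ _

theorem mixedPartial_testFunction (r : Fin d → ℕ) {φ : (Fin d → ℝ) → ℝ}
    (h : ContDiff ℝ (⊤ : ℕ∞) φ ∧ HasCompactSupport φ) :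
    ContDiff ℝ (⊤ : ℕ∞) (mixedPartial r φ) ∧ HasCompactSupport (mixedPartial r φ) := by
  unfold mixedPartial
  induction List.finRange d with
  | nil => exact h
  | cons i l ih =>
    simp only [List.foldr_cons]
    induction r i with
    | zero => exact ih
    | succ n ihn =>
      rw [Function.iterate_succ_apply']
      exact partialDeriv_testFunction i ihn

theorem integrable_test_smul {φ : (Fin d → ℝ) → ℝ}
    (h : ContDiff ℝ (⊤ : ℕ∞) φ ∧ HasCompactSupport φ) {f : (Fin d → ℝ) → 𝕜}
    (hf : LocallyIntegrable f volume) : Integrable (fun x => φ x • f x) volume :=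
  hf.integrable_smul_left_of_hasCompactSupport h.1.continuous h.2

theorem IsWeakDeriv.zero (r : Fin d → ℕ) :
    IsWeakDeriv r (0 : (Fin d → ℝ) → 𝕜) 0 :=
  ⟨locallyIntegrable_zero, locallyIntegrable_zero, by intros; simp⟩

theorem IsWeakDeriv.add {r : Fin d → ℕ} {f h f' h' : (Fin d → ℝ) → 𝕜}
    (H : IsWeakDeriv r f h) (H' : IsWeakDeriv r f' h') :
    IsWeakDeriv r (f + f') (h + h') := by
  refine ⟨H.1.add H'.1, H.2.1.add H'.2.1, fun φ h1 h2 => ?_⟩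
  have hD := mixedPartial_testFunction r ⟨h1, h2⟩
  simp only [Pi.add_apply, smul_add]
  rw [integral_add (integrable_test_smul hD H.1) (integrable_test_smul hD H'.1),
    integral_add (integrable_test_smul ⟨h1, h2⟩ H.2.1) (integrable_test_smul ⟨h1, h2⟩ H'.2.1),
    H.2.2 φ h1 h2, H'.2.2 φ h1 h2, mul_add]

theorem IsWeakDeriv.const_smul {r : Fin d → ℕ} {f h : (Fin d → ℝ) → 𝕜} (c : 𝕜)
    (H : IsWeakDeriv r f h) : IsWeakDeriv r (c • f) (c • h) := by
  refine ⟨H.1.smul c, H.2.1.smul c, fun φ h1 h2 => ?_⟩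
  simp only [Pi.smul_apply, smul_comm _ c]
  rw [integral_smul, integral_smul, H.2.2 φ h1 h2, smul_eq_mul, smul_eq_mul]
  ring

theorem locallyIntegrable_congr_ae {f f' : (Fin d → ℝ) → 𝕜} (hf : f =ᵐ[volume] f')
    (H : LocallyIntegrable f volume) : LocallyIntegrable f' volume := fun x => by
  obtain ⟨s, hs, h⟩ := H x
  exact ⟨s, hs, h.congr (ae_restrict_of_ae hf)⟩

theorem IsWeakDeriv.congr_ae {r : Fin d → ℕ} {f h f' h' : (Fin d → ℝ) → 𝕜}
    (H : IsWeakDeriv r f h) (hf : f =ᵐ[volume] f') (hh : h =ᵐ[volume] h') :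
    IsWeakDeriv r f' h' := by
  refine ⟨locallyIntegrable_congr_ae hf H.1, locallyIntegrable_congr_ae hh H.2.1,
    fun φ h1 h2 => ?_⟩
  have e1 : ∫ x, mixedPartial r φ x • f x = ∫ x, mixedPartial r φ x • f' x :=
    integral_congr_ae (hf.mono fun x hx => by simp only [hx])
  have e2 : ∫ x, φ x • h x = ∫ x, φ x • h' x :=
    integral_congr_ae (hh.mono fun x hx => by simp only [hx])
  rw [← e1, ← e2]
  exact H.2.2 φ h1 h2

/-- `u` pulls `μ`-integrable functions back to locally integrable functions, with control. -/
def LocallyControlled (u : (Fin d → ℝ) → (Fin d → ℝ)) (μ : Measure (Fin d → ℝ)) : Prop :=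
  Measurable u ∧ ∀ K : Set (Fin d → ℝ), IsCompact K →
    ∃ c : ℝ≥0∞, c ≠ ∞ ∧ (volume.restrict K).map u ≤ c • μ

theorem LocallyControlled.ae_comp {u : (Fin d → ℝ) → (Fin d → ℝ)} {μ : Measure (Fin d → ℝ)}
    (H : LocallyControlled u μ) {P : (Fin d → ℝ) → Prop} (hP : ∀ᵐ x ∂μ, P x) :
    ∀ᵐ x, P (u x) := by
  have key : ∀ n : ℕ, ∀ᵐ x ∂(volume.restrict (Metric.closedBall (0 : Fin d → ℝ) n)), P (u x) := by
    intro n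
    obtain ⟨c, -, hc⟩ := H.2 _ (isCompact_closedBall (0 : Fin d → ℝ) n)
    have : ∀ᵐ y ∂((volume.restrict (Metric.closedBall (0 : Fin d → ℝ) n)).map u), P y :=
      (Measure.absolutelyContinuous_of_le_smul hc) hP
    exact ae_of_ae_map H.1.aemeasurable this
  have h2 := (ae_restrict_iUnion_iff (μ := volume)
    (fun n : ℕ => Metric.closedBall (0 : Fin d → ℝ) n) (fun x => P (u x))).2 key
  rwa [Metric.iUnion_closedBall_nat, Measure.restrict_univ] at h2

theorem LocallyControlled.lintegral_le {u : (Fin d → ℝ) → (Fin d → ℝ)}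
    {μ : Measure (Fin d → ℝ)} [IsFiniteMeasure μ] (H : LocallyControlled u μ)
    (p : ℝ≥0∞) [Fact (1 ≤ p)] (K : Set (Fin d → ℝ)) (hK : IsCompact K) :
    ∃ c : ℝ≥0∞, c ≠ ∞ ∧ ∀ f : Lp 𝕜 p μ, ∫⁻ x in K, ‖f (u x)‖ₑ ≤ c * eLpNorm f p μ := by
  obtain ⟨c, hc, hle⟩ := H.2 K hK
  refine ⟨c * (μ Set.univ ^ (1 / (1 : ℝ≥0∞).toReal - 1 / p.toReal)),
    ENNReal.mul_ne_top hc ?_, fun f => ?_⟩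
  · refine ENNReal.rpow_ne_top_of_nonneg ?_ (measure_ne_top μ _)
    have h1 : (1 : ℝ≥0∞) ≤ p := Fact.out
    rcases eq_or_ne p ∞ with h | h
    · simp [h]
    · have : 1 ≤ p.toReal := by
        simpa using ENNReal.toReal_mono h h1
      simp only [ENNReal.toReal_one, div_one, sub_nonneg]
      simpa using inv_le_one_of_one_le₀ this
  · have hm : Measurable fun y => ‖f y‖ₑ := (Lp.stronglyMeasurable f).measurable.enorm
    calc ∫⁻ x in K, ‖f (u x)‖ₑ
        = ∫⁻ y, ‖f y‖ₑ ∂((volume.restrict K).map u) := (lintegral_map hm H.1).symm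
      _ ≤ ∫⁻ y, ‖f y‖ₑ ∂(c • μ) := lintegral_mono' hle le_rfl
      _ = c * eLpNorm f 1 μ := by
        rw [lintegral_smul_measure, eLpNorm_one_eq_lintegral_enorm, smul_eq_mul]
      _ ≤ c * (eLpNorm f p μ * μ Set.univ ^ (1 / (1 : ℝ≥0∞).toReal - 1 / p.toReal)) := by
        gcongr
        exact eLpNorm_le_eLpNorm_mul_rpow_measure_univ Fact.out (Lp.aestronglyMeasurable f)
      _ = _ := by ring

theorem LocallyControlled.locallyIntegrable {u : (Fin d → ℝ) → (Fin d → ℝ)}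
    {μ : Measure (Fin d → ℝ)} [IsFiniteMeasure μ] (H : LocallyControlled u μ)
    {p : ℝ≥0∞} [Fact (1 ≤ p)] (f : Lp 𝕜 p μ) :
    LocallyIntegrable (fun x => f (u x)) volume := by
  refine (locallyIntegrable_iff).2 fun K hK => ?_
  obtain ⟨c, hc, hle⟩ := H.lintegral_le (𝕜 := 𝕜) p K hK
  refine ⟨((Lp.stronglyMeasurable f).comp_measurable H.1).aestronglyMeasurable, ?_⟩
  exact (hle f).trans_lt (ENNReal.mul_lt_top hc.lt_top (Lp.eLpNorm_lt_top f))

theorem LocallyControlled.continuous_integral {u : (Fin d → ℝ) → (Fin d → ℝ)}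
    {μ : Measure (Fin d → ℝ)} [IsFiniteMeasure μ] (H : LocallyControlled u μ)
    (p : ℝ≥0∞) [Fact (1 ≤ p)] {φ : (Fin d → ℝ) → ℝ}
    (hφ : ContDiff ℝ (⊤ : ℕ∞) φ ∧ HasCompactSupport φ) :
    Continuous fun f : Lp 𝕜 p μ => ∫ x, φ x • f (u x) := by
  obtain ⟨c, hc, hle⟩ := H.lintegral_le (𝕜 := 𝕜) p _ hφ.2
  obtain ⟨M, hM⟩ := hφ.2.exists_bound_of_continuous hφ.1.continuous
  let L : Lp 𝕜 p μ →ₗ[𝕜] 𝕜 :=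
    { toFun := fun f => ∫ x, φ x • f (u x)
      map_add' := fun f g => by
        rw [← integral_add (integrable_test_smul hφ (H.locallyIntegrable f))
          (integrable_test_smul hφ (H.locallyIntegrable g))]
        refine integral_congr_ae ((H.ae_comp (Lp.coeFn_add f g)).mono fun x hx => ?_)
        simp only [hx, Pi.add_apply, smul_add]
      map_smul' := fun a f => by
        simp only [RingHom.id_apply]
        rw [← integral_smul]
        refine integral_congr_ae ((H.ae_comp (Lp.coeFn_smul a f)).mono fun x hx => ?_)
        simp only [hx, Pi.smul_apply, smul_comm _ a] }
  have hb : ∀ f, ‖L f‖ ≤ (ENNReal.ofReal M * c).toReal * ‖f‖ := by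
    intro f
    have h1 : ‖L f‖ₑ ≤ ENNReal.ofReal M * c * eLpNorm f p μ := by
      calc ‖L f‖ₑ ≤ ∫⁻ x, ‖φ x • f (u x)‖ₑ := enorm_integral_le_lintegral_enorm _
        _ = ∫⁻ x in tsupport φ, ‖φ x • f (u x)‖ₑ := by
          symm
          apply setLIntegral_eq_of_support_subset
          intro x hx
          apply subset_tsupport
          intro h0
          apply hx
          simp [h0]
        _ ≤ ∫⁻ x in tsupport φ, ENNReal.ofReal M * ‖f (u x)‖ₑ := by
          refine lintegral_mono fun x => ?_
          rw [enorm_smul]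
          gcongr
          rw [← ofReal_norm]
          exact ENNReal.ofReal_le_ofReal (hM x)
        _ = ENNReal.ofReal M * ∫⁻ x in tsupport φ, ‖f (u x)‖ₑ :=
          lintegral_const_mul' _ _ ENNReal.ofReal_ne_top
        _ ≤ _ := by
          rw [mul_assoc]
          gcongr
          exact hle f
    have h2 := ENNReal.toReal_mono
      (ENNReal.mul_ne_top (ENNReal.mul_ne_top ENNReal.ofReal_ne_top hc)
        (Lp.eLpNorm_ne_top f)) h1
    rw [ENNReal.toReal_mul] at h2
    simpa [Lp.norm_def] using h2
  exact (L.mkContinuous _ hb).continuous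

theorem LocallyControlled.isClosed_isWeakDeriv {u : (Fin d → ℝ) → (Fin d → ℝ)}
    {μ : Measure (Fin d → ℝ)} [IsFiniteMeasure μ] (H : LocallyControlled u μ)
    (p : ℝ≥0∞) [Fact (1 ≤ p)] (r : Fin d → ℕ) :
    IsClosed {F : Lp 𝕜 p μ × Lp 𝕜 p μ |
      IsWeakDeriv r (fun x => F.1 (u x)) (fun x => F.2 (u x))} := by
  have : {F : Lp 𝕜 p μ × Lp 𝕜 p μ |
      IsWeakDeriv r (fun x => F.1 (u x)) (fun x => F.2 (u x))} =
      ⋂ (φ : (Fin d → ℝ) → ℝ) (_ : ContDiff ℝ (⊤ : ℕ∞) φ) (_ : HasCompactSupport φ),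
        {F : Lp 𝕜 p μ × Lp 𝕜 p μ | ∫ x, mixedPartial r φ x • F.1 (u x) =
          (-1 : 𝕜) ^ (∑ i, r i) * ∫ x, φ x • F.2 (u x)} := by
    ext F
    simp only [Set.mem_ofPred_eq, Set.mem_iInter, IsWeakDeriv]
    exact ⟨fun h => h.2.2, fun h => ⟨H.locallyIntegrable F.1, H.locallyIntegrable F.2, h⟩⟩
  rw [this]
  refine isClosed_iInter fun φ => isClosed_iInter fun h1 => isClosed_iInter fun h2 => ?_
  exact isClosed_eq
    ((H.continuous_integral p (mixedPartial_testFunction r ⟨h1, h2⟩)).comp continuous_fst)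
    (continuous_const.mul ((H.continuous_integral p ⟨h1, h2⟩).comp continuous_snd))

end WeakDerivFacts

/-- The inclusion `L_p(μ) → L_q(μ)`, `q ≤ p`, for a finite measure `μ`. -/
noncomputable def lpInclusion (𝕜 : Type) [RCLike 𝕜] {E : Type} [MeasurableSpace E]
    (μ : Measure E) [IsFiniteMeasure μ] {p q : ℝ≥0∞} [Fact (1 ≤ p)] [Fact (1 ≤ q)]
    (hqp : q ≤ p) : Lp 𝕜 p μ →L[𝕜] Lp 𝕜 q μ :=
  LinearMap.mkContinuous
    { toFun := fun f => ⟨f.1, Lp.antitone hqp f.2⟩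
      map_add' := fun _ _ => rfl
      map_smul' := fun _ _ => rfl }
    (μ Set.univ ^ (1 / q.toReal - 1 / p.toReal)).toReal
    (fun f => by
      have hexp : 0 ≤ 1 / q.toReal - 1 / p.toReal := by
        have h1 : (1 : ℝ≥0∞) ≤ q := Fact.out
        rcases eq_or_ne p ∞ with h | h
        · simp [h]
        · have hq : q ≠ ∞ := ne_top_of_le_ne_top h hqp
          have h2 : 1 ≤ q.toReal := by simpa using ENNReal.toReal_mono hq h1
          have h3 := ENNReal.toReal_mono h hqp
          rw [sub_nonneg]
          exact one_div_le_one_div_of_le (by linarith) h3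
      have h := eLpNorm_le_eLpNorm_mul_rpow_measure_univ hqp (Lp.aestronglyMeasurable f)
      have h2 := ENNReal.toReal_mono (ENNReal.mul_ne_top (Lp.eLpNorm_ne_top f)
        (ENNReal.rpow_ne_top_of_nonneg hexp (measure_ne_top μ _))) h
      rw [ENNReal.toReal_mul, mul_comm] at h2
      exact h2)

/-! ### The Gaussian-weighted spaces on `ℝ^d` -/

/-- The density `g(x) = (2π)^{-d/2} exp(-|x|²/2)`, `|x|` the Euclidean norm. -/
noncomputable def gaussianDensity (d : ℕ) (x : Fin d → ℝ) : ℝ :=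
  (2 * Real.pi) ^ (-(d : ℝ) / 2) * Real.exp (-(∑ i, x i ^ 2) / 2)

/-- The standard Gaussian measure `γ(dx) = g(x) dx` on `ℝ^d`. -/
noncomputable def gaussianMeasure (d : ℕ) : Measure (Fin d → ℝ) :=
  volume.withDensity fun x => ENNReal.ofReal (gaussianDensity d x)

theorem gaussianDensity_pos (d : ℕ) (x : Fin d → ℝ) : 0 < gaussianDensity d x := by
  unfold gaussianDensity
  have := Real.pi_pos
  positivity

theorem continuous_gaussianDensity (d : ℕ) : Continuous (gaussianDensity d) := by
  unfold gaussianDensity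
  fun_prop

theorem integral_gaussianDensity (d : ℕ) : ∫ x, gaussianDensity d x = 1 := by
  have h : ∀ x : Fin d → ℝ, gaussianDensity d x =
      (2 * Real.pi) ^ (-(d : ℝ) / 2) * ∏ i, Real.exp (-(1 / 2) * x i ^ 2) := by
    intro x
    rw [gaussianDensity, ← Real.exp_sum, ← Finset.mul_sum]
    congr 2
    ring
  simp_rw [h]
  rw [integral_const_mul,
    integral_fintype_prod_volume_eq_pow (fun t : ℝ => Real.exp (-(1 / 2) * t ^ 2)),
    integral_gaussian, Fintype.card_fin, Real.sqrt_eq_rpow, ← Real.rpow_natCast,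
    ← Real.rpow_mul (by have := Real.pi_pos; positivity),
    show Real.pi / (1 / 2) = 2 * Real.pi by ring,
    ← Real.rpow_add (by have := Real.pi_pos; positivity)]
  rw [show -(d : ℝ) / 2 + 1 / 2 * d = 0 by ring, Real.rpow_zero]

instance isProbabilityMeasure_gaussianMeasure (d : ℕ) :
    IsProbabilityMeasure (gaussianMeasure d) := by
  have hint : Integrable (gaussianDensity d) := by
    by_contra hcon
    have := integral_gaussianDensity d
    rw [integral_undef hcon] at this
    exact zero_ne_one this
  constructor
  rw [gaussianMeasure, withDensity_apply _ MeasurableSet.univ, Measure.restrict_univ,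
    ← ofReal_integral_eq_lintegral_ofReal hint
      (Eventually.of_forall fun x => (gaussianDensity_pos d x).le),
    integral_gaussianDensity, ENNReal.ofReal_one]

theorem locallyControlled_gaussianMeasure (d : ℕ) :
    LocallyControlled (fun x => x) (gaussianMeasure d) := by
  refine ⟨measurable_id, fun K hK => ?_⟩
  rw [show (fun x : Fin d → ℝ => x) = id from rfl, Measure.map_id]
  rcases K.eq_empty_or_nonempty with rfl | hne
  · exact ⟨0, ENNReal.zero_ne_top, by simp⟩
  obtain ⟨x₀, -, hx₀⟩ := hK.exists_isMinOn hne (continuous_gaussianDensity d).continuousOn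
  have hm := gaussianDensity_pos d x₀
  refine ⟨(ENNReal.ofReal (gaussianDensity d x₀))⁻¹, by simpa using hm, ?_⟩
  rw [Measure.le_iff]
  intro s hs
  rw [Measure.restrict_apply hs, Measure.smul_apply, smul_eq_mul, gaussianMeasure,
    withDensity_apply _ hs]
  have h0 : ENNReal.ofReal (gaussianDensity d x₀) ≠ 0 := by simpa using hm
  have h1 : ENNReal.ofReal (gaussianDensity d x₀) * volume (s ∩ K) ≤
      ∫⁻ x in s, ENNReal.ofReal (gaussianDensity d x) := by
    calc ENNReal.ofReal (gaussianDensity d x₀) * volume (s ∩ K)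
        = ∫⁻ _ in s ∩ K, ENNReal.ofReal (gaussianDensity d x₀) := by simp
      _ ≤ ∫⁻ x in s ∩ K, ENNReal.ofReal (gaussianDensity d x) := by
        refine setLIntegral_mono' (hs.inter hK.measurableSet) fun x hx => ?_
        exact ENNReal.ofReal_le_ofReal (hx₀ hx.2)
      _ ≤ _ := lintegral_mono_set Set.inter_subset_left
  calc volume (s ∩ K) = (ENNReal.ofReal (gaussianDensity d x₀))⁻¹ *
        (ENNReal.ofReal (gaussianDensity d x₀) * volume (s ∩ K)) := by
        rw [← mul_assoc, ENNReal.inv_mul_cancel h0 ENNReal.ofReal_ne_top, one_mul]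
    _ ≤ _ := by gcongr

/-- The Gaussian-weighted Sobolev space `W^α_p(ℝ^d, γ)` of mixed smoothness `α`.  A function `f`
in it is represented by the family of all its weak derivatives `F r = D^r f ∈ L_p(ℝ^d, γ)`,
`r ∈ ℕ₀^d`, `max_i r_i ≤ α` (so `F 0 = f`, which determines `F`).  The norm inherited from the
`ℓ_p`-sum is `‖f‖ = (∑_r ‖D^r f‖_{L_p(ℝ^d, γ)}^p)^{1/p}`. -/
noncomputable def gaussianSobolev (𝕜 : Type) [RCLike 𝕜] (d α : ℕ) (p : ℝ≥0∞) [Fact (1 ≤ p)] :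
    Submodule 𝕜 (PiLp p fun _ : Fin d → Fin (α + 1) => Lp 𝕜 p (gaussianMeasure d)) where
  carrier := {F | ∀ r, IsWeakDeriv (fun i => (r i : ℕ)) (F 0) (F r)}
  zero_mem' := fun r => by
    have h0 : (0 : (Fin d → ℝ) → 𝕜) =ᵐ[volume] ((0 : Lp 𝕜 p (gaussianMeasure d)) : _ → 𝕜) :=
      ((locallyControlled_gaussianMeasure d).ae_comp (Lp.coeFn_zero 𝕜 p _)).mono
        fun x hx => hx.symm
    exact (IsWeakDeriv.zero _).congr_ae h0 h0
  add_mem' := fun {F G} hF hG r => by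
    have h0 : ∀ r, (F r + G r : (Fin d → ℝ) → 𝕜) =ᵐ[volume] ((F r + G r : Lp 𝕜 p _) : _ → 𝕜) :=
      fun r => ((locallyControlled_gaussianMeasure d).ae_comp (Lp.coeFn_add (F r) (G r))).mono
        fun x hx => hx.symm
    exact ((hF r).add (hG r)).congr_ae (h0 0) (h0 r)
  smul_mem' := fun c {F} hF r => by
    have h0 : ∀ r, (c • F r : (Fin d → ℝ) → 𝕜) =ᵐ[volume] ((c • F r : Lp 𝕜 p _) : _ → 𝕜) :=
      fun r => ((locallyControlled_gaussianMeasure d).ae_comp (Lp.coeFn_smul c (F r))).mono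
        fun x hx => hx.symm
    exact ((hF r).const_smul c).congr_ae (h0 0) (h0 r)

instance completeSpace_gaussianSobolev (𝕜 : Type) [RCLike 𝕜] (d α : ℕ) (p : ℝ≥0∞)
    [Fact (1 ≤ p)] : CompleteSpace (gaussianSobolev 𝕜 d α p) := by
  apply IsClosed.completeSpace_coe (hs := ?_)
  have : ((gaussianSobolev 𝕜 d α p : Set _)) = ⋂ r : Fin d → Fin (α + 1),
      (fun F : PiLp p fun _ : Fin d → Fin (α + 1) => Lp 𝕜 p (gaussianMeasure d) =>
        (F 0, F r)) ⁻¹' {F | IsWeakDeriv (fun i => (r i : ℕ)) (fun x => F.1 x) (fun x => F.2 x)} := by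
    ext F
    simp only [Set.mem_iInter]
    rfl
  rw [this]
  refine isClosed_iInter fun r => IsClosed.preimage (by fun_prop) ?_
  exact (locallyControlled_gaussianMeasure d).isClosed_isWeakDeriv p _

/-- The embedding `I_γ : W^α_p(ℝ^d, γ) → L_q(ℝ^d, γ)`, `f ↦ f`, for `q ≤ p`. -/
noncomputable def gaussianEmbedding (𝕜 : Type) [RCLike 𝕜] (d α : ℕ) (p q : ℝ≥0∞)
    [Fact (1 ≤ p)] [Fact (1 ≤ q)] (hqp : q ≤ p) :
    gaussianSobolev 𝕜 d α p →L[𝕜] Lp 𝕜 q (gaussianMeasure d) :=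
  (lpInclusion 𝕜 (gaussianMeasure d) hqp).comp
    ((PiLp.proj p (fun _ : Fin d → Fin (α + 1) => Lp 𝕜 p (gaussianMeasure d)) 0).comp
      (gaussianSobolev 𝕜 d α p).subtypeL)

/-! ### The periodic spaces -/

/-- The cube `𝕀^d = [-1/2, 1/2]^d`. -/
def unitCube (d : ℕ) : Set (Fin d → ℝ) := Set.Icc (fun _ => -(1 / 2)) (fun _ => 1 / 2)

/-- Lebesgue measure on the cube `𝕀^d`. -/
noncomputable def cubeMeasure (d : ℕ) : Measure (Fin d → ℝ) := volume.restrict (unitCube d)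

/-- `F` is `1`-periodic in each variable. -/
def IsOnePeriodic {𝕜 : Type} {d : ℕ} (F : (Fin d → ℝ) → 𝕜) : Prop :=
  ∀ i, Function.Periodic F (Pi.single i 1)

instance isFiniteMeasure_cubeMeasure (d : ℕ) : IsFiniteMeasure (cubeMeasure d) :=
  ⟨by
    rw [cubeMeasure, Measure.restrict_apply_univ]
    exact (isCompact_Icc).measure_lt_top⟩

/-- Reduction of a point of `ℝ^d` modulo `ℤ^d` to the cube. -/
noncomputable def wrap {d : ℕ} (x : Fin d → ℝ) : Fin d → ℝ :=
  fun i => Int.fract (x i + 1 / 2) - 1 / 2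

section PeriodicFacts

variable {𝕜 : Type} {d : ℕ}

theorem wrap_add_floor (x : Fin d → ℝ) :
    wrap x + (fun i => (⌊x i + 1 / 2⌋ : ℝ)) = x := by
  funext i
  simp only [Pi.add_apply, wrap, Int.fract]
  ring

theorem wrap_mem_unitCube (x : Fin d → ℝ) : wrap x ∈ unitCube d := by
  constructor <;> intro i
  · have := Int.fract_nonneg (x i + 1 / 2)
    simp only [wrap]
    linarith
  · have := Int.fract_lt_one (x i + 1 / 2)
    simp only [wrap]
    linarith

theorem measurable_wrap : Measurable (wrap (d := d)) := by
  unfold wrap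
  refine measurable_pi_lambda _ fun i => ?_
  exact (measurable_fract.comp ((measurable_pi_apply i).add_const _)).sub_const _

theorem IsOnePeriodic.add_int {F : (Fin d → ℝ) → 𝕜} (hF : IsOnePeriodic F) (x : Fin d → ℝ)
    (k : Fin d → ℤ) : F (x + fun i => (k i : ℝ)) = F x := by
  have key : ∀ s : Finset (Fin d), Function.Periodic F (∑ i ∈ s, k i • Pi.single i (1 : ℝ)) := by
    intro s
    induction s using Finset.induction_on with
    | empty => intro x; simp
    | insert i s hi ih =>
      rw [Finset.sum_insert hi]
      exact ((hF i).zsmul (k i)).add_period ih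
  have h := key Finset.univ x
  rw [← h]
  congr 2
  funext j
  simp [Finset.sum_apply, Pi.single_apply]

theorem IsOnePeriodic.comp_wrap_eq {F : (Fin d → ℝ) → 𝕜} (hF : IsOnePeriodic F) (x : Fin d → ℝ) :
    F (wrap x) = F x := by
  conv_rhs => rw [← wrap_add_floor x]
  exact (hF.add_int (wrap x) fun i => ⌊x i + 1 / 2⌋).symm

theorem isOnePeriodic_comp_wrap (F : (Fin d → ℝ) → 𝕜) : IsOnePeriodic fun x => F (wrap x) := by
  intro i x
  have : wrap (x + Pi.single i 1) = wrap x := by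
    funext j
    rcases eq_or_ne j i with rfl | h
    · simp only [wrap, Pi.add_apply, Pi.single_eq_same]
      rw [add_right_comm, Int.fract_add_one]
    · simp [wrap, h]
  simp only [this]

theorem wrap_ae_eq : ∀ᵐ x ∂(cubeMeasure d), wrap x = x := by
  have h : cubeMeasure d = volume.restrict
      (Set.univ.pi fun _ : Fin d => Set.Ico (-(1 / 2) : ℝ) (1 / 2)) :=
    Measure.restrict_congr_set (Measure.univ_pi_Ico_ae_eq_Icc).symm
  rw [h]
  refine ae_restrict_of_forall_mem (MeasurableSet.univ_pi fun _ => measurableSet_Ico)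
    fun x hx => ?_
  funext i
  have hi := hx i (Set.mem_univ i)
  simp only [wrap]
  rw [Int.fract_eq_self.2 ⟨by linarith [hi.1], by linarith [hi.2]⟩]
  ring

theorem locallyControlled_wrap : LocallyControlled (wrap (d := d)) (cubeMeasure d) := by
  refine ⟨measurable_wrap, fun K hK => ?_⟩
  obtain ⟨R, hR⟩ := hK.isBounded.subset_closedBall (0 : Fin d → ℝ)
  let S : Finset (Fin d → ℤ) :=
    Fintype.piFinset fun _ => Finset.Icc ⌊-R + 1 / 2⌋ ⌊R + 1 / 2⌋
  refine ⟨(S.card : ℝ≥0∞), ENNReal.natCast_ne_top _, ?_⟩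
  rw [Measure.le_iff]
  intro A hA
  have hpre : MeasurableSet (wrap (d := d) ⁻¹' A) := measurable_wrap hA
  have hcube : MeasurableSet (unitCube d) := measurableSet_Icc
  rw [Measure.map_apply measurable_wrap hA, Measure.restrict_apply hpre, Measure.smul_apply,
    smul_eq_mul, cubeMeasure, Measure.restrict_apply hA]
  have hsub : wrap ⁻¹' A ∩ K ⊆
      ⋃ k ∈ S, (fun x : Fin d → ℝ => x + -(fun i => (k i : ℝ))) ⁻¹' (A ∩ unitCube d) := by
    rintro x ⟨hxA, hxK⟩
    have hx := hR hxK
    rw [mem_closedBall_zero_iff] at hx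
    refine Set.mem_iUnion₂.2 ⟨fun i => ⌊x i + 1 / 2⌋, ?_, ?_⟩
    · refine Fintype.mem_piFinset.2 fun i => Finset.mem_Icc.2 ?_
      have hi := abs_le.1 ((norm_le_pi_norm x i).trans hx)
      exact ⟨Int.floor_le_floor (by linarith [hi.1]), Int.floor_le_floor (by linarith [hi.2])⟩
    · have : x + -(fun i => (⌊x i + 1 / 2⌋ : ℝ)) = wrap x := by
        conv_lhs => lhs; rw [← wrap_add_floor x]
        rw [add_neg_cancel_right]
      simp only [Set.mem_preimage, this]
      exact ⟨hxA, wrap_mem_unitCube x⟩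
  calc volume (wrap ⁻¹' A ∩ K)
      ≤ ∑ k ∈ S, volume ((fun x : Fin d → ℝ => x + -(fun i => (k i : ℝ))) ⁻¹'
          (A ∩ unitCube d)) := (measure_mono hsub).trans (measure_biUnion_finset_le _ _)
    _ = ∑ _ ∈ S, volume (A ∩ unitCube d) := by
      refine Finset.sum_congr rfl fun k _ => ?_
      exact measure_preimage_add_right _ _ _
    _ = _ := by simp

end PeriodicFacts

/-- The space `L̃_q(𝕀^d)`: the subspace of `L_q(𝕀^d)` of all functions that extend to
`1`-periodic functions on `ℝ^d`. -/
noncomputable def periodicLp (𝕜 : Type) [RCLike 𝕜] (d : ℕ) (q : ℝ≥0∞) :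
    Submodule 𝕜 (Lp 𝕜 q (cubeMeasure d)) where
  carrier := {f | ∃ G : (Fin d → ℝ) → 𝕜, IsOnePeriodic G ∧ G =ᵐ[cubeMeasure d] f}
  zero_mem' := ⟨0, fun _ _ => rfl, (Lp.coeFn_zero 𝕜 q _).symm⟩
  add_mem' := by
    rintro f f' ⟨G, hG, h⟩ ⟨G', hG', h'⟩
    exact ⟨G + G', fun i => (hG i).add (hG' i), (h.add h').trans (Lp.coeFn_add f f').symm⟩
  smul_mem' := by
    rintro c f ⟨G, hG, h⟩
    exact ⟨c • G, fun i x => congrArg (c • ·) (hG i x), (h.const_smul c).trans (Lp.coeFn_smul c f).symm⟩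

instance completeSpace_periodicLp (𝕜 : Type) [RCLike 𝕜] (d : ℕ) (q : ℝ≥0∞) [Fact (1 ≤ q)] :
    CompleteSpace (periodicLp 𝕜 d q) := by
  have : ((periodicLp 𝕜 d q : Set (Lp 𝕜 q (cubeMeasure d)))) = Set.univ := by
    refine Set.eq_univ_of_forall fun f => ⟨fun x => f (wrap x), isOnePeriodic_comp_wrap _, ?_⟩
    exact wrap_ae_eq.mono fun x hx => by simp only [hx]
  exact IsClosed.completeSpace_coe (hs := by rw [this]; exact isClosed_univ)

/-- The periodic Sobolev space `W̃^α_p(𝕀^d)` of mixed smoothness `α`: the functions on the cube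
whose `1`-periodic extension to `ℝ^d` has weak derivatives `D^r`, `max_i r_i ≤ α`, that are
`1`-periodic with restriction in `L_p(𝕀^d)`.  As for `gaussianSobolev`, a function `f` is
represented by the family `F r = D^r f ∈ L_p(𝕀^d)` (so `F 0 = f`, which determines `F`), and the
norm is `‖f‖ = (∑_r ‖D^r f‖_{L_p(𝕀^d)}^p)^{1/p}`.  The function `G r` is the `1`-periodic
extension of `F r`. -/
noncomputable def periodicSobolev (𝕜 : Type) [RCLike 𝕜] (d α : ℕ) (p : ℝ≥0∞) [Fact (1 ≤ p)] :
    Submodule 𝕜 (PiLp p fun _ : Fin d → Fin (α + 1) => Lp 𝕜 p (cubeMeasure d)) where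
  carrier := {F | ∃ G : (Fin d → Fin (α + 1)) → (Fin d → ℝ) → 𝕜,
    (∀ r, IsOnePeriodic (G r)) ∧ (∀ r, G r =ᵐ[cubeMeasure d] F r) ∧
    ∀ r, IsWeakDeriv (fun i => (r i : ℕ)) (G 0) (G r)}
  zero_mem' := ⟨0, fun _ _ _ => rfl, fun _ => (Lp.coeFn_zero 𝕜 p _).symm,
    fun _ => IsWeakDeriv.zero _⟩
  add_mem' := by
    rintro F F' ⟨G, hG, h, hw⟩ ⟨G', hG', h', hw'⟩
    exact ⟨G + G', fun r i => (hG r i).add (hG' r i),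
      fun r => ((h r).add (h' r)).trans (Lp.coeFn_add (F r) (F' r)).symm,
      fun r => (hw r).add (hw' r)⟩
  smul_mem' := by
    rintro c F ⟨G, hG, h, hw⟩
    exact ⟨c • G, fun r i x => congrArg (c • ·) (hG r i x),
      fun r => ((h r).const_smul c).trans (Lp.coeFn_smul c (F r)).symm,
      fun r => (hw r).const_smul c⟩

theorem mem_periodicSobolev_iff {𝕜 : Type} [RCLike 𝕜] {d α : ℕ} {p : ℝ≥0∞} [Fact (1 ≤ p)]
    {F : PiLp p fun _ : Fin d → Fin (α + 1) => Lp 𝕜 p (cubeMeasure d)} :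
    F ∈ periodicSobolev 𝕜 d α p ↔ ∀ r : Fin d → Fin (α + 1),
      IsWeakDeriv (fun i => (r i : ℕ)) (fun x => F 0 (wrap x)) (fun x => F r (wrap x)) := by
  constructor
  · rintro ⟨G, hG, h, hw⟩ r
    have key : ∀ r, G r =ᵐ[volume] fun x => F r (wrap x) := fun r =>
      (locallyControlled_wrap.ae_comp (h r)).mono fun x hx => by
        rw [← (hG r).comp_wrap_eq x, hx]
    exact (hw r).congr_ae (key 0) (key r)
  · intro h
    exact ⟨fun r x => F r (wrap x), fun r => isOnePeriodic_comp_wrap _,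
      fun r => wrap_ae_eq.mono fun x hx => by simp only [hx], h⟩

instance completeSpace_periodicSobolev (𝕜 : Type) [RCLike 𝕜] (d α : ℕ) (p : ℝ≥0∞)
    [Fact (1 ≤ p)] : CompleteSpace (periodicSobolev 𝕜 d α p) := by
  apply IsClosed.completeSpace_coe (hs := ?_)
  have : ((periodicSobolev 𝕜 d α p : Set _)) = ⋂ r : Fin d → Fin (α + 1),
      (fun F : PiLp p fun _ : Fin d → Fin (α + 1) => Lp 𝕜 p (cubeMeasure d) =>
        (F 0, F r)) ⁻¹' {F | IsWeakDeriv (fun i => (r i : ℕ))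
          (fun x => F.1 (wrap x)) (fun x => F.2 (wrap x))} := by
    ext F
    simp only [Set.mem_iInter]
    exact mem_periodicSobolev_iff
  rw [this]
  refine isClosed_iInter fun r => IsClosed.preimage (by fun_prop) ?_
  exact locallyControlled_wrap.isClosed_isWeakDeriv p _

/-- The embedding `I : W̃^α_p(𝕀^d) → L̃_q(𝕀^d)`, `f ↦ f`, for `q ≤ p`. -/
noncomputable def periodicEmbedding (𝕜 : Type) [RCLike 𝕜] (d α : ℕ) (p q : ℝ≥0∞)
    [Fact (1 ≤ p)] [Fact (1 ≤ q)] (hqp : q ≤ p) :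
    periodicSobolev 𝕜 d α p →L[𝕜] periodicLp 𝕜 d q :=
  ((lpInclusion 𝕜 (cubeMeasure d) hqp).comp
    ((PiLp.proj p (fun _ : Fin d → Fin (α + 1) => Lp 𝕜 p (cubeMeasure d)) 0).comp
      (periodicSobolev 𝕜 d α p).subtypeL)).codRestrict (periodicLp 𝕜 d q)
    (fun F => by
      obtain ⟨G, hG, h, -⟩ := F.2
      exact ⟨G 0, hG 0, h 0⟩)

end MixedSobolev

/-! Both halves compare the two embeddings by factoring one through the other.

Lower bound. The integer translates of the Gaussian density sum to a bounded function on the cube,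
so periodic extension `A` is bounded into the Gaussian Sobolev space (`exists_periodicExtension`).
The density is bounded below on the cube, so restriction `B` to the cube is bounded on `L_q(γ)`.
Extending and then restricting changes nothing, hence `J I = B I_γ A`, where `J` includes `L̃_q` in
`L_q` (`exists_periodicEmbedding_factorization`). The ideal inequality bounds `s_n(JI)` by a
multiple of `s_n(I_γ)`, and weak injectivity removes `J`.

Upper bound. Cut `ℝ^d` into tiles `Q_k` of side 1/2 centred at `k/2`. Translate `f` by `k/2`,
multiply by a bump that is 1 on the centred tile and vanishes near the boundary of the unit cube,
and periodize: the result is a periodic Sobolev function that agrees with the translate of `f` on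
the tile. So multiplication by the indicator of `Q_k` factors as `B_k I A_k`
(`exists_localization`). Here `‖A_k‖` is of order at most `(min g)^(-1/p)` and `‖B_k‖` at most `(max
g)^(1/q)`, with the extrema taken over the unit cube about `k/2`. As `q < p`, the product of these
bounds decays like a Gaussian in `k`, and `I_γ = ∑ B_k I A_k` converges in operator norm
(`exists_gaussianEmbedding_decomposition`).

It remains to sum rates (`PseudoSNumber.isBigO_num_of_hasSum`). If the norm products are at most
`w_k`, additivity allows a budget `n` to be split into `N_k` proportional to `w_k^(1/(1+a))`, the
split that balances `∑ w_k N_k^(-a)`. This costs only the constant `∑ w_k^(1/(1+a)) < ∞`, so the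
rate of `I` is kept without losing a logarithm. -/

namespace MixedSobolev

/-! ### Partial derivatives of test functions: commutation, translation, product rule. -/

section Calculus

variable {d : ℕ}

theorem partialDeriv_comm (i j : Fin d) {φ : (Fin d → ℝ) → ℝ} (h : ContDiff ℝ (⊤ : ℕ∞) φ) :
    partialDeriv i (partialDeriv j φ) = partialDeriv j (partialDeriv i φ) := by
  have hd : Differentiable ℝ (fderiv ℝ φ) :=
    (h.fderiv_right (m := (⊤ : ℕ∞)) (by simp)).differentiable (by simp)
  have key : ∀ (a b : Fin d) (x : Fin d → ℝ), partialDeriv a (partialDeriv b φ) x =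
      fderiv ℝ (fderiv ℝ φ) x (Pi.single a 1) (Pi.single b 1) := by
    intro a b x
    unfold partialDeriv
    rw [fderiv_clm_apply (hd x) (differentiableAt_const _)]
    simp
  funext x
  rw [key, key]
  exact (h.contDiffAt.isSymmSndFDerivAt (by
    rw [minSmoothness_of_isRCLikeNormedField]
    exact WithTop.coe_le_coe.2 (le_top : (2 : ℕ∞) ≤ ⊤))).eq _ _

theorem partialDeriv_iterate_testFunction (i : Fin d) (n : ℕ) {φ : (Fin d → ℝ) → ℝ}
    (h : ContDiff ℝ (⊤ : ℕ∞) φ ∧ HasCompactSupport φ) :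
    ContDiff ℝ (⊤ : ℕ∞) ((partialDeriv i)^[n] φ) ∧
      HasCompactSupport ((partialDeriv i)^[n] φ) := by
  induction n with
  | zero => exact h
  | succ n ih =>
    rw [Function.iterate_succ_apply']
    exact partialDeriv_testFunction i ih

theorem partialDeriv_iterate_comm (i j : Fin d) (n : ℕ) {φ : (Fin d → ℝ) → ℝ}
    (h : ContDiff ℝ (⊤ : ℕ∞) φ ∧ HasCompactSupport φ) :
    (partialDeriv j)^[n] (partialDeriv i φ) = partialDeriv i ((partialDeriv j)^[n] φ) := by
  induction n with
  | zero => rfl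
  | succ n ih =>
    rw [Function.iterate_succ_apply', Function.iterate_succ_apply', ih,
      partialDeriv_comm _ _ (partialDeriv_iterate_testFunction j n h).1]

theorem foldr_partialDeriv_testFunction (l : List (Fin d)) (r : Fin d → ℕ)
    {φ : (Fin d → ℝ) → ℝ} (h : ContDiff ℝ (⊤ : ℕ∞) φ ∧ HasCompactSupport φ) :
    ContDiff ℝ (⊤ : ℕ∞) (l.foldr (fun i ψ => (partialDeriv i)^[r i] ψ) φ) ∧
      HasCompactSupport (l.foldr (fun i ψ => (partialDeriv i)^[r i] ψ) φ) := by
  induction l with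
  | nil => exact h
  | cons i l ih => exact partialDeriv_iterate_testFunction i _ ih

theorem foldr_partialDeriv_comm (l : List (Fin d)) (r : Fin d → ℕ) (i : Fin d)
    {φ : (Fin d → ℝ) → ℝ} (h : ContDiff ℝ (⊤ : ℕ∞) φ ∧ HasCompactSupport φ) :
    l.foldr (fun i ψ => (partialDeriv i)^[r i] ψ) (partialDeriv i φ) =
      partialDeriv i (l.foldr (fun i ψ => (partialDeriv i)^[r i] ψ) φ) := by
  induction l with
  | nil => rfl
  | cons j l ih =>
    simp only [List.foldr_cons]
    rw [ih, partialDeriv_iterate_comm i j _ (foldr_partialDeriv_testFunction l r h)]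

/-- Since `l` has no repetition, the extra derivative enters at a single place, and symmetry of
second derivatives moves it innermost. -/
theorem foldr_partialDeriv_add_single (l : List (Fin d)) (hl : l.Nodup) (r : Fin d → ℕ)
    (i : Fin d) {φ : (Fin d → ℝ) → ℝ} (h : ContDiff ℝ (⊤ : ℕ∞) φ ∧ HasCompactSupport φ) :
    l.foldr (fun j ψ => (partialDeriv j)^[(r + Pi.single i 1 : Fin d → ℕ) j] ψ) φ =
      if i ∈ l then l.foldr (fun j ψ => (partialDeriv j)^[r j] ψ) (partialDeriv i φ)
      else l.foldr (fun j ψ => (partialDeriv j)^[r j] ψ) φ := by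
  induction l with
  | nil => simp
  | cons j l ih =>
    obtain ⟨hj, hl'⟩ := List.nodup_cons.1 hl
    have ih := ih hl'
    simp only [List.foldr_cons, List.mem_cons]
    rw [ih]
    by_cases hij : i = j
    · subst hij
      simp only [hj, if_false, true_or, if_true, Pi.add_apply, Pi.single_eq_same]
      rw [foldr_partialDeriv_comm l r i h, Function.iterate_succ_apply]
    · simp only [hij, false_or, Pi.add_apply, Pi.single_eq_of_ne' hij, add_zero]
      split_ifs <;> rfl

/-- With the extra derivative innermost, an identity for `D^r` can be tested against `∂_i φ`; this
drives every induction on the order. -/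
theorem mixedPartial_add_single (r : Fin d → ℕ) (i : Fin d) {φ : (Fin d → ℝ) → ℝ}
    (h : ContDiff ℝ (⊤ : ℕ∞) φ ∧ HasCompactSupport φ) :
    mixedPartial (r + Pi.single i 1) φ = mixedPartial r (partialDeriv i φ) := by
  unfold mixedPartial
  rw [foldr_partialDeriv_add_single _ (List.nodup_finRange d) r i h,
    if_pos (List.mem_finRange i)]

theorem mixedPartial_zero (φ : (Fin d → ℝ) → ℝ) : mixedPartial 0 φ = φ := by
  unfold mixedPartial
  induction List.finRange d with
  | nil => rfl
  | cons i l ih => simp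

theorem mixedPartial_single (i : Fin d) {φ : (Fin d → ℝ) → ℝ}
    (h : ContDiff ℝ (⊤ : ℕ∞) φ ∧ HasCompactSupport φ) :
    mixedPartial (Pi.single i 1) φ = partialDeriv i φ := by
  rw [← zero_add (Pi.single i 1), mixedPartial_add_single 0 i h, mixedPartial_zero]

theorem partialDeriv_comp_add (i : Fin d) (φ : (Fin d → ℝ) → ℝ) (v : Fin d → ℝ) :
    partialDeriv i (fun x => φ (x + v)) = fun x => partialDeriv i φ (x + v) := by
  funext x
  simp only [partialDeriv]
  rw [fderiv_comp_add_right]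

theorem mixedPartial_comp_add (r : Fin d → ℕ) (φ : (Fin d → ℝ) → ℝ) (v : Fin d → ℝ) :
    mixedPartial r (fun x => φ (x + v)) = fun x => mixedPartial r φ (x + v) := by
  unfold mixedPartial
  induction List.finRange d with
  | nil => rfl
  | cons i l ih =>
    simp only [List.foldr_cons]
    rw [ih]
    induction r i with
    | zero => rfl
    | succ n ihn =>
      rw [Function.iterate_succ_apply', ihn, partialDeriv_comp_add, Function.iterate_succ_apply']

theorem partialDeriv_mul (i : Fin d) {φ ψ : (Fin d → ℝ) → ℝ} (hφ : ContDiff ℝ (⊤ : ℕ∞) φ)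
    (hψ : ContDiff ℝ (⊤ : ℕ∞) ψ) :
    partialDeriv i (fun x => φ x * ψ x) =
      fun x => φ x * partialDeriv i ψ x + partialDeriv i φ x * ψ x := by
  funext x
  simp only [partialDeriv]
  rw [fderiv_fun_mul (hφ.differentiable (by simp) x) (hψ.differentiable (by simp) x)]
  simp [mul_comm]

theorem tsupport_partialDeriv_subset (i : Fin d) (φ : (Fin d → ℝ) → ℝ) :
    tsupport (partialDeriv i φ) ⊆ tsupport φ := by
  exact tsupport_fderiv_apply_subset ℝ _

end Calculus

/-! ### Weak derivatives: Leibniz rule, locality, periodization. -/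

section WeakDerivCalculus

variable {𝕜 : Type} [RCLike 𝕜] {d : ℕ}

theorem IsWeakDeriv.trans_single {r : Fin d → ℕ} {i : Fin d} {f g h : (Fin d → ℝ) → 𝕜}
    (H : IsWeakDeriv r f g) (H' : IsWeakDeriv (Pi.single i 1) g h) :
    IsWeakDeriv (r + Pi.single i 1) f h := by
  refine ⟨H.1, H'.2.1, fun φ h1 h2 => ?_⟩
  have hD := partialDeriv_testFunction i ⟨h1, h2⟩
  have e := H'.2.2 φ h1 h2
  rw [mixedPartial_single i ⟨h1, h2⟩] at e
  rw [mixedPartial_add_single r i ⟨h1, h2⟩, H.2.2 _ hD.1 hD.2, e, ← mul_assoc, ← pow_add]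
  simp [Finset.sum_add_distrib]

/-- Test the relation for `D^r` with `∂_i φ` and cancel the sign. This recovers first-order
relations between members of a family of derivatives, which the Leibniz induction needs. -/
theorem IsWeakDeriv.single_of_add_single {r : Fin d → ℕ} {i : Fin d}
    {f g h : (Fin d → ℝ) → 𝕜}
    (H : IsWeakDeriv r f g) (H' : IsWeakDeriv (r + Pi.single i 1) f h) :
    IsWeakDeriv (Pi.single i 1) g h := by
  refine ⟨H.2.1, H'.2.1, fun φ h1 h2 => ?_⟩
  have hD := partialDeriv_testFunction i ⟨h1, h2⟩
  have e := H'.2.2 φ h1 h2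
  rw [mixedPartial_add_single r i ⟨h1, h2⟩, H.2.2 _ hD.1 hD.2] at e
  simp only [Pi.add_apply, Finset.sum_add_distrib, pow_add, mul_assoc] at e
  rw [mixedPartial_single i ⟨h1, h2⟩]
  exact mul_left_cancel₀ (pow_ne_zero _ (by simp)) e

theorem locallyIntegrable_continuous_smul {φ : (Fin d → ℝ) → ℝ} (h : Continuous φ)
    {f : (Fin d → ℝ) → 𝕜} (hf : LocallyIntegrable f volume) :
    LocallyIntegrable (fun x => φ x • f x) volume := by
  rw [locallyIntegrable_iff] at hf ⊢
  intro K hK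
  exact (hf K hK).continuousOn_smul h.continuousOn hK

/-- Use `φ c` as the test function and expand `∂_i(φ c)`. -/
theorem IsWeakDeriv.smul_single {i : Fin d} {g h : (Fin d → ℝ) → 𝕜}
    (H : IsWeakDeriv (Pi.single i 1) g h) {c : (Fin d → ℝ) → ℝ}
    (hc : ContDiff ℝ (⊤ : ℕ∞) c ∧ HasCompactSupport c) :
    IsWeakDeriv (Pi.single i 1) (fun x => c x • g x)
      (fun x => partialDeriv i c x • g x + c x • h x) := by
  have hc' := partialDeriv_testFunction i hc
  have i1 := locallyIntegrable_continuous_smul hc.1.continuous H.1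
  have i2 := locallyIntegrable_continuous_smul hc'.1.continuous H.1
  have i3 := locallyIntegrable_continuous_smul hc.1.continuous H.2.1
  refine ⟨i1, i2.add i3, fun φ h1 h2 => ?_⟩
  have hD := partialDeriv_testFunction i ⟨h1, h2⟩
  have hφc : ContDiff ℝ (⊤ : ℕ∞) (fun x => φ x * c x) ∧ HasCompactSupport (fun x => φ x * c x) :=
    ⟨h1.mul hc.1, h2.mul_right⟩
  have e := H.2.2 _ hφc.1 hφc.2
  rw [mixedPartial_single i hφc, partialDeriv_mul i h1 hc.1] at e
  rw [mixedPartial_single i ⟨h1, h2⟩]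
  have s : ∑ j, (Pi.single i 1 : Fin d → ℕ) j = 1 := by simp
  rw [s, pow_one] at e ⊢
  simp only [smul_add]
  rw [integral_add (integrable_test_smul ⟨h1, h2⟩ i2) (integrable_test_smul ⟨h1, h2⟩ i3)]
  simp only [add_smul, mul_smul] at e
  rw [integral_add (integrable_test_smul ⟨h1, h2⟩ i2) (integrable_test_smul hD i1)] at e
  linear_combination e

theorem IsWeakDeriv.finset_sum {ι : Type*} (s : Finset ι) {r : Fin d → ℕ}
    {f h : ι → (Fin d → ℝ) → 𝕜} (H : ∀ j ∈ s, IsWeakDeriv r (f j) (h j)) :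
    IsWeakDeriv r (fun x => ∑ j ∈ s, f j x) (fun x => ∑ j ∈ s, h j x) := by
  classical
  induction s using Finset.induction_on with
  | empty =>
    simp only [Finset.sum_empty]
    exact IsWeakDeriv.zero r
  | insert j s hj ih =>
    simp only [Finset.sum_insert hj]
    exact (H j (Finset.mem_insert_self _ _)).add
      (ih fun k hk => H k (Finset.mem_insert_of_mem hk))

theorem locallyIntegrable_comp_add {f : (Fin d → ℝ) → 𝕜} (hf : LocallyIntegrable f volume)
    (v : Fin d → ℝ) : LocallyIntegrable (fun x => f (x + v)) volume := by
  intro x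
  obtain ⟨s, hs, h⟩ := hf (x + v)
  refine ⟨(fun y => y + v) ⁻¹' s, (continuous_add_const v).continuousAt.preimage_mem_nhds hs, ?_⟩
  exact ((measurePreserving_add_right volume v).integrableOn_comp_preimage
    (MeasurableEquiv.addRight v).measurableEmbedding).2 h

theorem IsWeakDeriv.comp_add {r : Fin d → ℕ} {f h : (Fin d → ℝ) → 𝕜}
    (H : IsWeakDeriv r f h) (v : Fin d → ℝ) :
    IsWeakDeriv r (fun x => f (x + v)) (fun x => h (x + v)) := by
  refine ⟨locallyIntegrable_comp_add H.1 v, locallyIntegrable_comp_add H.2.1 v,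
    fun φ h1 h2 => ?_⟩
  have hφ : ContDiff ℝ (⊤ : ℕ∞) (fun x => φ (x + -v)) := h1.comp (contDiff_id.add contDiff_const)
  have hφ' : HasCompactSupport (fun x => φ (x + -v)) :=
    h2.comp_homeomorph (Homeomorph.addRight (-v))
  have e := H.2.2 _ hφ hφ'
  rw [mixedPartial_comp_add,
    ← integral_add_right_eq_self (fun x => mixedPartial r φ (x + -v) • f x) v,
    ← integral_add_right_eq_self (fun x => φ (x + -v) • h x) v] at e
  simpa using e

/-- A test function and its mixed partial see only a compact set, so the notion is local.
Periodizations can thus be treated as finite sums. -/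
theorem IsWeakDeriv.of_eqOn_compact {r : Fin d → ℕ} {f h : (Fin d → ℝ) → 𝕜}
    (H : ∀ K : Set (Fin d → ℝ), IsCompact K → ∃ f' h' : (Fin d → ℝ) → 𝕜,
      IsWeakDeriv r f' h' ∧ Set.EqOn f f' K ∧ Set.EqOn h h' K) : IsWeakDeriv r f h := by
  refine ⟨?_, ?_, fun φ h1 h2 => ?_⟩
  · refine locallyIntegrable_iff.2 fun K hK => ?_
    obtain ⟨f', h', hw, hf, -⟩ := H K hK
    exact (locallyIntegrable_iff.1 hw.1 K hK).congr_fun hf.symm hK.measurableSet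
  · refine locallyIntegrable_iff.2 fun K hK => ?_
    obtain ⟨f', h', hw, -, hh⟩ := H K hK
    exact (locallyIntegrable_iff.1 hw.2.1 K hK).congr_fun hh.symm hK.measurableSet
  · have hD := mixedPartial_testFunction r ⟨h1, h2⟩
    obtain ⟨f', h', hw, hf, hh⟩ := H (tsupport φ ∪ tsupport (mixedPartial r φ))
      (IsCompact.union h2 hD.2)
    have aux : ∀ (ψ : (Fin d → ℝ) → ℝ) (u u' : (Fin d → ℝ) → 𝕜), Set.EqOn u u' (tsupport ψ) →
        ∫ x, ψ x • u x = ∫ x, ψ x • u' x := by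
      intro ψ u u' he
      congr 1
      funext x
      by_cases hx : x ∈ tsupport ψ
      · rw [he hx]
      · simp [image_eq_zero_of_notMem_tsupport hx]
    rw [aux _ _ _ (hf.mono Set.subset_union_right), aux _ _ _ (hh.mono Set.subset_union_left)]
    exact hw.2.2 φ h1 h2

/-- The Leibniz rule for the weak derivatives of a product with a test function. -/
theorem exists_leibniz {φ : (Fin d → ℝ) → ℝ}
    (hφ : ContDiff ℝ (⊤ : ℕ∞) φ ∧ HasCompactSupport φ) (r : Fin d → ℕ) :
    ∃ (ι : Type) (_ : Fintype ι) (c : ι → (Fin d → ℝ) → ℝ) (l : ι → Fin d → ℕ),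
      (∀ j, ContDiff ℝ (⊤ : ℕ∞) (c j) ∧ HasCompactSupport (c j)) ∧
      (∀ j, tsupport (c j) ⊆ tsupport φ) ∧ (∀ j, l j ≤ r) ∧
      (r = 0 → ∀ (F : (Fin d → ℕ) → (Fin d → ℝ) → 𝕜) x,
        ∑ j, c j x • F (l j) x = φ x • F 0 x) ∧
      ∀ F : (Fin d → ℕ) → (Fin d → ℝ) → 𝕜, (∀ l ≤ r, IsWeakDeriv l (F 0) (F l)) →
        IsWeakDeriv r (fun x => φ x • F 0 x) (fun x => ∑ j, c j x • F (l j) x) := by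
  obtain ⟨n, hn⟩ : ∃ n, ∑ i, r i = n := ⟨_, rfl⟩
  induction n generalizing r with
  | zero =>
    have hr : r = 0 := by
      funext i
      exact (Finset.sum_eq_zero_iff.1 hn) i (Finset.mem_univ i)
    subst hr
    refine ⟨Unit, inferInstance, fun _ => φ, fun _ => 0, fun _ => hφ, fun _ => subset_rfl,
      fun _ => le_rfl, fun _ F x => by simp, fun F hF => ?_⟩
    have h0 := locallyIntegrable_continuous_smul hφ.1.continuous (hF 0 le_rfl).1
    refine ⟨h0, by simpa using h0, fun η h1 h2 => ?_⟩
    simp [mixedPartial_zero]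
  | succ n ih =>
    obtain ⟨i, hi⟩ : ∃ i, r i ≠ 0 := by
      by_contra! hcon
      simp [hcon] at hn
    obtain ⟨r', rfl⟩ : ∃ r' : Fin d → ℕ, r = r' + Pi.single i 1 := by
      refine ⟨r - Pi.single i 1, ?_⟩
      rw [tsub_add_cancel_of_le]
      intro j
      rcases eq_or_ne j i with rfl | h
      · simp [Nat.one_le_iff_ne_zero, hi]
      · simp [h]
    have hn' : ∑ i, r' i = n := by
      simpa [Finset.sum_add_distrib] using hn
    obtain ⟨ι, _, c, l, hc, hs, hl, -, hw⟩ := ih r' hn'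
    -- Differentiating each term once more gives two copies of the index set: on the left the
    -- derivative hits the coefficient, on the right it raises the multi-index. Binomial
    -- coefficients are never collected.
    refine ⟨ι ⊕ ι, inferInstance, Sum.elim (fun j => partialDeriv i (c j)) c,
      Sum.elim l (fun j => l j + Pi.single i 1), ?_, ?_, ?_, ?_, ?_⟩
    · rintro (j | j)
      · exact partialDeriv_testFunction i (hc j)
      · exact hc j
    · rintro (j | j)
      · exact (tsupport_partialDeriv_subset i _).trans (hs j)
      · exact hs j
    · rintro (j | j)
      · exact (hl j).trans (le_add_of_nonneg_right (by simp))
      · exact add_le_add_left (hl j) _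
    · intro h0
      have := congrFun h0 i
      simp at this
    · intro F hF
      have hF' : ∀ l ≤ r', IsWeakDeriv l (F 0) (F l) := fun l h =>
        hF l (h.trans (le_add_of_nonneg_right (by simp)))
      have h1 := (hw F hF').trans_single (i := i)
        (IsWeakDeriv.finset_sum Finset.univ (fun j _ =>
          ((hF' (l j) (hl j)).single_of_add_single
            (hF (l j + Pi.single i 1) (add_le_add_left (hl j) _))).smul_single (hc j)))
      simpa [Fintype.sum_sum_type, Finset.sum_add_distrib] using h1

/-- On a bounded set the periodization of a function supported in the open unit cube is a finite
sum of its translates. -/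
theorem comp_wrap_eq_sum {E : Type*} [AddCommMonoid E] (R : ℝ) {G : (Fin d → ℝ) → E}
    (hG : Function.support G ⊆ Metric.ball 0 (1 / 2)) {x : Fin d → ℝ} (hx : ‖x‖ ≤ R) :
    G (wrap x) = ∑ k ∈ Fintype.piFinset fun _ : Fin d => Finset.Icc ⌊-R + 1 / 2⌋ ⌊R + 1 / 2⌋,
      G (x + fun i => -(k i : ℝ)) := by
  rw [Finset.sum_eq_single (fun i => ⌊x i + 1 / 2⌋)]
  · congr 1
    conv_lhs => rw [← add_neg_cancel_right (wrap x) (fun i => (⌊x i + 1 / 2⌋ : ℝ)), wrap_add_floor]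
    rfl
  · intro k _ hk
    by_contra hne
    apply hk
    -- In the sup norm, `‖x - k‖ < 1/2` forces every `k i` to be the floor of `x i + 1/2`, so only
    -- one translate is nonzero at `x`.
    have hm := hG hne
    rw [mem_ball_zero_iff] at hm
    funext i
    have hi := abs_lt.1 ((norm_le_pi_norm _ i).trans_lt hm)
    simp only [Pi.add_apply] at hi
    symm
    rw [Int.floor_eq_iff]
    constructor <;> linarith [hi.1, hi.2]
  · intro hk
    exfalso
    apply hk
    refine Fintype.mem_piFinset.2 fun i => Finset.mem_Icc.2 ?_
    have hi := abs_le.1 ((norm_le_pi_norm x i).trans hx)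
    exact ⟨Int.floor_le_floor (by linarith [hi.1]), Int.floor_le_floor (by linarith [hi.2])⟩

/-- Near any compact set the periodization is a finite sum of integer translates, and weak
derivatives respect sums and translations. The open-ball support keeps the translates disjoint. -/
theorem IsWeakDeriv.comp_wrap {r : Fin d → ℕ} {f h : (Fin d → ℝ) → 𝕜} (H : IsWeakDeriv r f h)
    (hf : Function.support f ⊆ Metric.ball 0 (1 / 2))
    (hh : Function.support h ⊆ Metric.ball 0 (1 / 2)) :
    IsWeakDeriv r (fun x => f (wrap x)) (fun x => h (wrap x)) := by
  refine IsWeakDeriv.of_eqOn_compact fun K hK => ?_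
  obtain ⟨R, hR⟩ := hK.isBounded.subset_closedBall (0 : Fin d → ℝ)
  exact ⟨_, _, IsWeakDeriv.finset_sum
    (Fintype.piFinset fun _ : Fin d => Finset.Icc ⌊-R + 1 / 2⌋ ⌊R + 1 / 2⌋)
    (fun k _ => H.comp_add fun i => -(k i : ℝ)),
    fun x hx => comp_wrap_eq_sum R hf (mem_closedBall_zero_iff.1 (hR hx)),
    fun x hx => comp_wrap_eq_sum R hh (mem_closedBall_zero_iff.1 (hR hx))⟩

end WeakDerivCalculus

/-! ### Weighted composition on `L_p`; lattice sums of Gaussians. -/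

/-- Weighted composition operators `f ↦ m · (f ∘ u)` between `L_p` spaces. -/
theorem exists_weightedComp (𝕜 : Type) [RCLike 𝕜] {E : Type} [MeasurableSpace E]
    {p : ℝ≥0∞} [Fact (1 ≤ p)] (hp : p ≠ ∞) {μ ν : Measure E} {m : E → ℝ} {u : E → E}
    {s : Set E} {M c : ℝ} (hm : Measurable m) (hu : Measurable u) (hs : MeasurableSet s)
    (hms : ∀ x ∉ s, m x = 0) (hM0 : 0 ≤ M) (hM : ∀ x, |m x| ≤ M) (hc0 : 0 ≤ c)
    (hc : (μ.restrict s).map u ≤ ENNReal.ofReal c • ν) :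
    ∃ T : Lp 𝕜 p ν →L[𝕜] Lp 𝕜 p μ, (∀ f, T f =ᵐ[μ] fun x => m x • f (u x)) ∧
      ‖T‖ ≤ M * c ^ (1 / p.toReal) := by
  have hmeas : ∀ f : Lp 𝕜 p ν, AEStronglyMeasurable (fun x => m x • f (u x)) μ := fun f =>
    hm.aestronglyMeasurable.smul
      ((Lp.stronglyMeasurable f).comp_measurable hu).aestronglyMeasurable
  have hbound : ∀ f : Lp 𝕜 p ν, eLpNorm (fun x => m x • f (u x)) p μ ≤
      ENNReal.ofReal (M * c ^ (1 / p.toReal)) * eLpNorm f p ν := by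
    intro f
    have e : (fun x => m x • f (u x)) = s.indicator (fun x => m x • f (u x)) := by
      funext x
      by_cases hx : x ∈ s
      · simp [hx]
      · simp [hx, hms x hx]
    calc eLpNorm (fun x => m x • f (u x)) p μ
        = eLpNorm (fun x => m x • f (u x)) p (μ.restrict s) := by
          conv_lhs => rw [e]
          exact eLpNorm_indicator_eq_eLpNorm_restrict hs
      _ ≤ ENNReal.ofReal M * eLpNorm (fun x => f (u x)) p (μ.restrict s) := by
          refine eLpNorm_le_mul_eLpNorm_of_ae_le_mul (Eventually.of_forall fun x => ?_) p
          rw [norm_smul, Real.norm_eq_abs]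
          gcongr
          exact hM x
      _ = ENNReal.ofReal M * eLpNorm f p ((μ.restrict s).map u) := by
          rw [eLpNorm_map_measure (Lp.stronglyMeasurable f).aestronglyMeasurable hu.aemeasurable]
          rfl
      _ ≤ ENNReal.ofReal M * eLpNorm f p (ENNReal.ofReal c • ν) := by
          gcongr
      _ = _ := by
          rw [eLpNorm_smul_measure_of_ne_top hp, smul_eq_mul, ENNReal.ofReal_mul hM0, mul_assoc,
            ← ENNReal.ofReal_rpow_of_nonneg hc0 (by positivity)]
          simp
  -- Independence of the representative: on `s` the image measure is absolutely continuous with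
  -- respect to `ν`, and off `s` the weight vanishes.
  have hcongr : ∀ f g : E → 𝕜, f =ᵐ[ν] g →
      (fun x => m x • f (u x)) =ᵐ[μ] fun x => m x • g (u x) := by
    intro f g h
    have h1 : ∀ᵐ y ∂((μ.restrict s).map u), f y = g y :=
      (Measure.absolutelyContinuous_of_le_smul hc) h
    have h2 := (ae_restrict_iff' hs).1 (ae_of_ae_map hu.aemeasurable h1)
    filter_upwards [h2] with x hx
    by_cases hxs : x ∈ s
    · rw [hx hxs]
    · simp [hms x hxs]
  have hmem : ∀ f : Lp 𝕜 p ν, MemLp (fun x => m x • f (u x)) p μ := fun f =>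
    ⟨hmeas f, (hbound f).trans_lt
      (ENNReal.mul_lt_top ENNReal.ofReal_lt_top (Lp.eLpNorm_lt_top f))⟩
  let L : Lp 𝕜 p ν →ₗ[𝕜] Lp 𝕜 p μ :=
    { toFun := fun f => (hmem f).toLp
      map_add' := fun f g => by
        rw [← MemLp.toLp_add]
        refine MemLp.toLp_congr _ _ ((hcongr _ _ (Lp.coeFn_add f g)).trans ?_)
        exact Eventually.of_forall fun x => by simp [smul_add]
      map_smul' := fun a f => by
        rw [← MemLp.toLp_const_smul]
        refine MemLp.toLp_congr _ _ ((hcongr _ _ (Lp.coeFn_smul a f)).trans ?_)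
        exact Eventually.of_forall fun x => by
          simp only [Pi.smul_apply, RingHom.id_apply, smul_comm _ a] }
  have hC : 0 ≤ M * c ^ (1 / p.toReal) := by positivity
  refine ⟨L.mkContinuous (M * c ^ (1 / p.toReal)) fun f => ?_, fun f => (hmem f).coeFn_toLp,
    L.mkContinuous_norm_le hC _⟩
  change ‖(hmem f).toLp‖ ≤ _
  rw [Lp.norm_toLp, Lp.norm_def]
  have := ENNReal.toReal_mono (ENNReal.mul_ne_top ENNReal.ofReal_ne_top (Lp.eLpNorm_ne_top f))
    (hbound f)
  rwa [ENNReal.toReal_mul, ENNReal.toReal_ofReal hC] at this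

theorem summable_pi_prod (d : ℕ) {f : ℤ → ℝ} (h0 : ∀ k, 0 ≤ f k) (hf : Summable f) :
    Summable fun k : Fin d → ℤ => ∏ i, f (k i) := by
  induction d with
  | zero => exact Summable.of_finite
  | succ d ih =>
    have h := hf.mul_of_nonneg ih h0 fun k => Finset.prod_nonneg fun i _ => h0 _
    rw [← (Fin.consEquiv fun _ : Fin (d + 1) => ℤ).summable_iff]
    refine h.congr fun x => ?_
    simp [Fin.prod_univ_succ]

theorem summable_exp_neg_mul_sq_int {δ : ℝ} (hδ : 0 < δ) :
    Summable fun k : ℤ => Real.exp (-δ * (k : ℝ) ^ 2) := by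
  have h : Summable fun n : ℕ => Real.exp (-δ * ((n : ℤ) : ℝ) ^ 2) := by
    refine Summable.of_nonneg_of_le (fun _ => (Real.exp_pos _).le) (fun n => ?_)
      (Real.summable_exp_nat_mul_iff.2 (neg_lt_zero.2 hδ))
    have h1 : (n : ℝ) ≤ (n : ℝ) ^ 2 := by
      exact_mod_cast Nat.le_self_pow two_ne_zero n
    rw [Real.exp_le_exp, Int.cast_natCast]
    nlinarith
  exact Summable.of_nat_of_neg h (by simpa using h)

theorem summable_exp_neg_mul_sum_sq (d : ℕ) {δ : ℝ} (hδ : 0 < δ) :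
    Summable fun k : Fin d → ℤ => Real.exp (-δ * ∑ i, (k i : ℝ) ^ 2) := by
  refine (summable_pi_prod d (fun k => (Real.exp_pos _).le)
    (summable_exp_neg_mul_sq_int hδ)).congr fun k => ?_
  rw [Finset.mul_sum, Real.exp_sum]

/-! ### The Gaussian density and measure on translated cubes. -/

section GaussianEstimates

variable {d : ℕ}

theorem mem_unitCube_iff {x : Fin d → ℝ} : x ∈ unitCube d ↔ ∀ i, |x i| ≤ 1 / 2 := by
  simp only [unitCube, Set.mem_Icc, Pi.le_def, abs_le, forall_and]

/-- Young's inequality absorbs the cross term `2 v z` at the price of a factor `1 - ε` in the rate.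
The strict inequality `q < p` later pays for this loss. -/
theorem gaussianDensity_add_le {ε : ℝ} (hε : 0 < ε) (v z : Fin d → ℝ) (hz : z ∈ unitCube d) :
    gaussianDensity d (v + z) ≤ (2 * Real.pi) ^ (-(d : ℝ) / 2) * Real.exp (d / (8 * ε)) *
      Real.exp (-((1 - ε) / 2) * ∑ i, v i ^ 2) := by
  have hpi := Real.pi_pos
  rw [gaussianDensity, mul_assoc, ← Real.exp_add]
  gcongr
  have key : ∑ i : Fin d, ((1 - ε) * v i ^ 2 - 1 / (4 * ε)) ≤ ∑ i, (v + z) i ^ 2 := by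
    refine Finset.sum_le_sum fun i _ => ?_
    have h := sq_le_sq' (abs_le.1 (mem_unitCube_iff.1 hz i)).1 (abs_le.1 (mem_unitCube_iff.1 hz i)).2
    have h2 : 0 ≤ (ε * v i + z i) ^ 2 / ε := by positivity
    have h3 : (ε * v i + z i) ^ 2 / ε = ε * v i ^ 2 + 2 * v i * z i + z i ^ 2 / ε := by
      field_simp
      ring
    have h4 : z i ^ 2 / ε ≤ 1 / (4 * ε) := by
      rw [show 1 / (4 * ε) = (1 / 2) ^ 2 / ε by field_simp; norm_num]
      gcongr
    simp only [Pi.add_apply]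
    nlinarith [sq_nonneg (z i)]
  rw [Finset.sum_sub_distrib, ← Finset.mul_sum] at key
  simp only [Finset.sum_const, Finset.card_univ, Fintype.card_fin, nsmul_eq_mul] at key
  have e : (d : ℝ) / (8 * ε) = (d * (1 / (4 * ε))) / 2 := by field_simp; ring
  rw [e]
  linarith

/-- The companion estimate, by Young's inequality with the opposite sign of the cross term. -/
theorem le_gaussianDensity_add {ε : ℝ} (hε : 0 < ε) (v z : Fin d → ℝ) (hz : z ∈ unitCube d) :
    (2 * Real.pi) ^ (-(d : ℝ) / 2) * Real.exp (-(d * (1 + 1 / ε) / 8)) *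
      Real.exp (-((1 + ε) / 2) * ∑ i, v i ^ 2) ≤ gaussianDensity d (v + z) := by
  have hpi := Real.pi_pos
  rw [gaussianDensity, mul_assoc, ← Real.exp_add]
  gcongr
  have key : ∑ i, (v + z) i ^ 2 ≤ ∑ i : Fin d, ((1 + ε) * v i ^ 2 + (1 + 1 / ε) / 4) := by
    refine Finset.sum_le_sum fun i _ => ?_
    have h := sq_le_sq' (abs_le.1 (mem_unitCube_iff.1 hz i)).1 (abs_le.1 (mem_unitCube_iff.1 hz i)).2
    have h2 : 0 ≤ (ε * v i - z i) ^ 2 / ε := by positivity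
    have h3 : (ε * v i - z i) ^ 2 / ε = ε * v i ^ 2 - 2 * v i * z i + 1 / ε * z i ^ 2 := by
      field_simp
      ring
    have h4 : 1 / ε * z i ^ 2 ≤ 1 / ε * (1 / 2) ^ 2 := by gcongr
    simp only [Pi.add_apply]
    nlinarith [sq_nonneg (z i)]
  rw [Finset.sum_add_distrib, ← Finset.mul_sum] at key
  simp only [Finset.sum_const, Finset.card_univ, Fintype.card_fin, nsmul_eq_mul] at key
  linarith

theorem measurableSet_unitCube : MeasurableSet (unitCube d) := measurableSet_Icc

/-- A translate of the Gaussian measure is controlled by Lebesgue measure on the cube. -/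
theorem gaussianMeasure_map_sub_le {v : Fin d → ℝ} {s : Set (Fin d → ℝ)} (hs : MeasurableSet s)
    (hsv : ∀ x ∈ s, x + -v ∈ unitCube d) {c : ℝ}
    (hc : ∀ z ∈ unitCube d, gaussianDensity d (v + z) ≤ c) :
    ((gaussianMeasure d).restrict s).map (fun x => x + -v) ≤
      ENNReal.ofReal c • cubeMeasure d := by
  have hu : Measurable fun x : Fin d → ℝ => x + -v := measurable_id.add_const _
  rw [Measure.le_iff]
  intro A hA
  rw [Measure.map_apply hu hA, Measure.restrict_apply (hu hA), Measure.smul_apply, smul_eq_mul,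
    cubeMeasure, Measure.restrict_apply hA, gaussianMeasure,
    withDensity_apply _ ((hu hA).inter hs)]
  calc ∫⁻ x in (fun x => x + -v) ⁻¹' A ∩ s, ENNReal.ofReal (gaussianDensity d x)
      ≤ ∫⁻ _ in (fun x => x + -v) ⁻¹' A ∩ s, ENNReal.ofReal c := by
        refine setLIntegral_mono' ((hu hA).inter hs) fun x hx => ENNReal.ofReal_le_ofReal ?_
        simpa using hc _ (hsv x hx.2)
    _ = ENNReal.ofReal c * volume ((fun x => x + -v) ⁻¹' A ∩ s) := by simp
    _ ≤ ENNReal.ofReal c * volume ((fun x => x + -v) ⁻¹' (A ∩ unitCube d)) := by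
        gcongr
        exact fun x hx => ⟨hx.1, hsv x hx.2⟩
    _ = _ := by rw [measure_preimage_add_right]

/-- Lebesgue measure on a translate of the cube is controlled by the Gaussian measure. -/
theorem cubeMeasure_map_add_le {v : Fin d → ℝ} {c : ℝ} (hc0 : 0 < c)
    (hc : ∀ z ∈ unitCube d, c ≤ gaussianDensity d (v + z)) :
    (cubeMeasure d).map (fun x => x + v) ≤ ENNReal.ofReal c⁻¹ • gaussianMeasure d := by
  have hu : Measurable fun x : Fin d → ℝ => x + v := measurable_id.add_const _
  have hu' : Measurable fun x : Fin d → ℝ => x + -v := measurable_id.add_const _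
  rw [Measure.le_iff]
  intro A hA
  rw [Measure.map_apply hu hA, Measure.smul_apply, smul_eq_mul,
    cubeMeasure, Measure.restrict_apply (hu hA), gaussianMeasure, withDensity_apply _ hA]
  have hB : MeasurableSet (A ∩ (fun x => x + -v) ⁻¹' unitCube d) :=
    hA.inter (hu' measurableSet_unitCube)
  have e : (fun x => x + v) ⁻¹' A ∩ unitCube d =
      (fun x => x + v) ⁻¹' (A ∩ (fun x => x + -v) ⁻¹' unitCube d) := by
    ext x
    simp
  rw [e, measure_preimage_add_right, ENNReal.ofReal_inv_of_pos hc0, ← ENNReal.div_eq_inv_mul,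
    ENNReal.le_div_iff_mul_le (by simp [hc0]) (by simp), mul_comm]
  calc ENNReal.ofReal c * volume (A ∩ (fun x => x + -v) ⁻¹' unitCube d)
      = ∫⁻ _ in A ∩ (fun x => x + -v) ⁻¹' unitCube d, ENNReal.ofReal c := by simp
    _ ≤ ∫⁻ x in A ∩ (fun x => x + -v) ⁻¹' unitCube d, ENNReal.ofReal (gaussianDensity d x) := by
        refine setLIntegral_mono' hB fun x hx => ENNReal.ofReal_le_ofReal ?_
        simpa using hc _ hx.2
    _ ≤ _ := lintegral_mono_set Set.inter_subset_left

/-- The periodization of the Gaussian measure is controlled by Lebesgue measure on the cube. -/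
theorem exists_gaussianMeasure_map_wrap_le (d : ℕ) :
    ∃ c : ℝ, 0 ≤ c ∧ (gaussianMeasure d).map wrap ≤ ENNReal.ofReal c • cubeMeasure d := by
  -- The upper density bound at `k` with `ε = 1/2`; any `ε` in `(0, 1)` would make the weights
  -- summable.
  let w : (Fin d → ℤ) → ℝ := fun k =>
    (2 * Real.pi) ^ (-(d : ℝ) / 2) * Real.exp (d / (8 * (1 / 2))) *
      Real.exp (-((1 - 1 / 2) / 2) * ∑ i, (k i : ℝ) ^ 2)
  have hpi := Real.pi_pos
  have hw0 : ∀ k, 0 ≤ w k := fun k => by positivity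
  have hw : Summable w := (summable_exp_neg_mul_sum_sq d (by norm_num)).mul_left _
  -- The cell on which `wrap` is translation by `-k`.
  let s : (Fin d → ℤ) → Set (Fin d → ℝ) := fun k => {x | ∀ i, ⌊x i + 1 / 2⌋ = k i}
  have hsm : ∀ k, MeasurableSet (s k) := fun k => by
    simp only [s, Set.ofPred_forall]
    exact MeasurableSet.iInter fun i =>
      (Int.measurable_floor.comp ((measurable_pi_apply i).add_const _)) (measurableSet_singleton _)
  have hsw : ∀ k, ∀ x ∈ s k, x + -(fun i => (k i : ℝ)) = wrap x := by
    intro k x hx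
    conv_lhs => rw [← wrap_add_floor x]
    have : (fun i => (⌊x i + 1 / 2⌋ : ℝ)) = fun i => (k i : ℝ) := by
      funext i
      rw [hx i]
    rw [this, add_neg_cancel_right]
  refine ⟨∑' k, w k, tsum_nonneg hw0, ?_⟩
  rw [Measure.le_iff]
  intro A hA
  rw [Measure.map_apply measurable_wrap hA, Measure.smul_apply, smul_eq_mul,
    ENNReal.ofReal_tsum_of_nonneg hw0 hw, ← ENNReal.tsum_mul_right]
  calc gaussianMeasure d (wrap ⁻¹' A)
      ≤ gaussianMeasure d (⋃ k, wrap ⁻¹' A ∩ s k) := by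
        refine measure_mono fun x hx => Set.mem_iUnion.2 ⟨fun i => ⌊x i + 1 / 2⌋, hx, fun i => rfl⟩
    _ ≤ ∑' k, gaussianMeasure d (wrap ⁻¹' A ∩ s k) := measure_iUnion_le _
    _ ≤ _ := by
        refine ENNReal.tsum_le_tsum fun k => ?_
        have h := gaussianMeasure_map_sub_le (v := fun i => (k i : ℝ)) (hsm k)
          (fun x hx => by rw [hsw k x hx]; exact wrap_mem_unitCube x)
          (fun z hz => gaussianDensity_add_le (by norm_num : (0 : ℝ) < 1 / 2) _ z hz) A
        have hu : Measurable fun x : Fin d → ℝ => x + -(fun i => (k i : ℝ)) :=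
          measurable_id.add_const _
        rw [Measure.map_apply hu hA, Measure.restrict_apply (hu hA), Measure.smul_apply,
          smul_eq_mul] at h
        refine le_trans (measure_mono ?_) h
        rintro x ⟨hxA, hxs⟩
        refine ⟨?_, hxs⟩
        rw [Set.mem_preimage, hsw k x hxs]
        exact hxA

end GaussianEstimates

/-! ### Summing rates of additive pseudo `s`-numbers. -/

section SNumbers

variable {𝕜 : Type} [RCLike 𝕜] (s : PseudoSNumber 𝕜)
  {X Y X₀ Y₀ : Type}
  [NormedAddCommGroup X] [NormedSpace 𝕜 X] [CompleteSpace X]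
  [NormedAddCommGroup Y] [NormedSpace 𝕜 Y] [CompleteSpace Y]
  [NormedAddCommGroup X₀] [NormedSpace 𝕜 X₀] [CompleteSpace X₀]
  [NormedAddCommGroup Y₀] [NormedSpace 𝕜 Y₀] [CompleteSpace Y₀]

theorem PseudoSNumber.num_le_num (T : X →L[𝕜] Y) {m n : ℕ} (hm : 1 ≤ m) (hmn : m ≤ n) :
    s.num T n ≤ s.num T m := by
  induction n, hmn using Nat.le_induction with
  | base => exact le_rfl
  | succ n h ih => exact (s.num_succ_le T n (hm.trans h)).trans ih

/-- Writing indices as `N + 1` absorbs the `-1` in additivity, so the shifted indices simply add.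
The empty sum uses `s_1(0) = ‖0‖ = 0`. -/
theorem PseudoSNumber.num_finset_sum_le {s : PseudoSNumber 𝕜} (hs : s.IsAdditive) {ι : Type*}
    (F : Finset ι) (T : ι → X →L[𝕜] Y) (N : ι → ℕ) :
    s.num (∑ k ∈ F, T k) (∑ k ∈ F, N k + 1) ≤ ∑ k ∈ F, s.num (T k) (N k + 1) := by
  classical
  induction F using Finset.induction_on with
  | empty => simp [s.num_one]
  | insert j F hj ih =>
    rw [Finset.sum_insert hj, Finset.sum_insert hj, Finset.sum_insert hj]
    have h := hs (T j) (∑ k ∈ F, T k) (N j + 1) (∑ k ∈ F, N k + 1) (by omega) (by omega)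
    rw [show N j + 1 + (∑ k ∈ F, N k + 1) - 1 = N j + ∑ k ∈ F, N k + 1 by omega] at h
    linarith

/-- Many tiles receive a tiny index, even `1`, where `log n` vanishes. Replacing it by `1 + log n`
gives a bound valid from `n = 1` on. -/
theorem PseudoSNumber.exists_num_le {a b : ℝ} (ha : 0 < a) (hb : 0 ≤ b) (I₀ : X₀ →L[𝕜] Y₀)
    (hI : (fun n : ℕ => s.num I₀ n) =O[atTop] fun n : ℕ => (n : ℝ) ^ (-a) * Real.log n ^ b) :
    ∃ C : ℝ, 0 ≤ C ∧ ∀ n : ℕ, 1 ≤ n →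
      s.num I₀ n ≤ C * ((n : ℝ) ^ (-a) * (1 + Real.log n) ^ b) := by
  obtain ⟨C, hC, h⟩ := hI.exists_nonneg
  obtain ⟨N, hN⟩ := eventually_atTop.1 h.bound
  -- The first summand serves `n ≥ N`; the second serves `n < N`, where `s_n ≤ ‖I₀‖` and `n^(-a) ≥
  -- (N+1)^(-a)`.
  refine ⟨C + ‖I₀‖ * ((N : ℝ) + 1) ^ a, by positivity, fun n hn => ?_⟩
  have hn' : (1 : ℝ) ≤ n := by exact_mod_cast hn
  have hlog := Real.log_nonneg hn'
  have hpos : 0 ≤ (n : ℝ) ^ (-a) * (1 + Real.log n) ^ b := by positivity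
  rcases le_or_gt N n with hle | hlt
  · have h1 := hN n hle
    rw [Real.norm_of_nonneg (s.num_nonneg I₀ n hn), Real.norm_of_nonneg (by positivity)] at h1
    calc s.num I₀ n ≤ C * ((n : ℝ) ^ (-a) * Real.log n ^ b) := h1
      _ ≤ C * ((n : ℝ) ^ (-a) * (1 + Real.log n) ^ b) := by
        gcongr
        linarith
      _ ≤ _ := by
        gcongr
        exact le_add_of_nonneg_right (by positivity)
  · have h1 : s.num I₀ n ≤ ‖I₀‖ := by
      rw [← s.num_one]
      exact s.num_le_num I₀ le_rfl hn
    have h2 : 1 ≤ ((N : ℝ) + 1) ^ a * (n : ℝ) ^ (-a) := by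
      rw [Real.rpow_neg (by positivity), ← div_eq_mul_inv, one_le_div (by positivity)]
      gcongr
      have : (n : ℝ) < N := by exact_mod_cast hlt
      linarith
    have h3 : 1 ≤ (1 + Real.log n) ^ b := Real.one_le_rpow (by linarith) hb
    calc s.num I₀ n ≤ ‖I₀‖ * 1 * 1 := by simpa using h1
      _ ≤ ‖I₀‖ * (((N : ℝ) + 1) ^ a * (n : ℝ) ^ (-a)) * (1 + Real.log n) ^ b := by
        gcongr
      _ = ‖I₀‖ * ((N : ℝ) + 1) ^ a * ((n : ℝ) ^ (-a) * (1 + Real.log n) ^ b) := by ring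
      _ ≤ _ := by
        gcongr
        exact le_add_of_nonneg_left hC

/-- If an operator is a sum of rapidly decreasing operators whose `s`-numbers are dominated by
those of a fixed operator, then it inherits the rate of decay for additive `s`. -/
theorem PseudoSNumber.isBigO_num_of_hasSum {s : PseudoSNumber 𝕜} (hs : s.IsAdditive) {a b : ℝ}
    (ha : 0 < a) (hb : 0 ≤ b) (I₀ : X₀ →L[𝕜] Y₀)
    (hI : (fun n : ℕ => s.num I₀ n) =O[atTop] fun n : ℕ => (n : ℝ) ^ (-a) * Real.log n ^ b)
    {ι : Type*} {T : ι → X →L[𝕜] Y} {S : X →L[𝕜] Y} (hS : HasSum T S) {w : ι → ℝ}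
    (hw0 : ∀ k, 0 < w k) (hw : Summable fun k => w k ^ (1 / (1 + a)))
    (hT : ∀ k n, 1 ≤ n → s.num (T k) n ≤ w k * s.num I₀ n) :
    (fun n : ℕ => s.num S n) =O[atTop] fun n : ℕ => (n : ℝ) ^ (-a) * Real.log n ^ b := by
  obtain ⟨C, hC, hCI⟩ := s.exists_num_le ha hb I₀ hI
  -- This exponent gives `w_k v_k^(-a) = v_k`: each share of the budget and the error it causes are
  -- proportional to the same summable sequence.
  set v : ι → ℝ := fun k => w k ^ (1 / (1 + a)) with hv
  have hv0 : ∀ k, 0 < v k := fun k => Real.rpow_pos_of_pos (hw0 k) _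
  have hvw : ∀ k, w k * v k ^ (-a) = v k := by
    intro k
    have h : w k = v k ^ (1 + a) := by
      rw [hv]
      simp only
      rw [← Real.rpow_mul (hw0 k).le, one_div, inv_mul_cancel₀ (by positivity), Real.rpow_one]
    rw [h, ← Real.rpow_add (hv0 k), add_neg_cancel_right, Real.rpow_one]
  -- The added `1` makes `V` positive even for an empty index type.
  set V : ℝ := ∑' k, v k + 1 with hV
  have hV0 : 0 < V := by
    have : 0 ≤ ∑' k, v k := tsum_nonneg fun k => (hv0 k).le
    linarith
  have hFV : ∀ F : Finset ι, ∑ k ∈ F, v k ≤ V := fun F => by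
    have := hw.sum_le_tsum F fun k _ => (hv0 k).le
    linarith
  have key : ∀ n : ℕ, 1 ≤ n → s.num S (n + 1) ≤
      C * V ^ a * V * ((n : ℝ) ^ (-a) * (1 + Real.log (n + 1)) ^ b) := by
    intro n hn
    have hn0 : (0 : ℝ) < n := by exact_mod_cast hn
    have hlog : 0 ≤ Real.log ((n : ℝ) + 1) := Real.log_nonneg (by linarith)
    -- Rounding down keeps the total within `n`, while `N k + 1` still exceeds the real share `n v_k
    -- / V`.
    let N : ι → ℕ := fun k => ⌊n * v k / V⌋₊
    have hfin : ∀ F : Finset ι, s.num (∑ k ∈ F, T k) (n + 1) ≤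
        C * V ^ a * V * ((n : ℝ) ^ (-a) * (1 + Real.log (n + 1)) ^ b) := by
      intro F
      have hN : ∑ k ∈ F, N k ≤ n := by
        have h1 : ((∑ k ∈ F, N k : ℕ) : ℝ) ≤ n := by
          push_cast
          calc ∑ k ∈ F, (N k : ℝ) ≤ ∑ k ∈ F, n * v k / V :=
                Finset.sum_le_sum fun k _ => Nat.floor_le (by have := hv0 k; positivity)
            _ = n * (∑ k ∈ F, v k) / V := by rw [← Finset.sum_div, ← Finset.mul_sum]
            _ ≤ n * V / V := by
              gcongr
              exact hFV F
            _ = n := by field_simp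
        exact_mod_cast h1
      have hterm : ∀ k ∈ F, s.num (T k) (N k + 1) ≤
          C * V ^ a * v k * ((n : ℝ) ^ (-a) * (1 + Real.log (n + 1)) ^ b) := by
        intro k hk
        have hvk := hv0 k
        have hNk : (N k : ℝ) ≤ n := by
          exact_mod_cast (Finset.single_le_sum (fun _ _ => Nat.zero_le _) hk).trans hN
        have hlt : n * v k / V ≤ ((N k + 1 : ℕ) : ℝ) := by
          push_cast
          exact (Nat.lt_floor_add_one _).le
        have hq : 0 < n * v k / V := by positivity
        have h1 : ((N k + 1 : ℕ) : ℝ) ^ (-a) ≤ (n * v k / V) ^ (-a) :=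
          Real.rpow_le_rpow_of_nonpos hq hlt (by linarith)
        have hl0 : 0 ≤ Real.log ((N k + 1 : ℕ) : ℝ) := Real.log_natCast_nonneg _
        have h2 : Real.log ((N k + 1 : ℕ) : ℝ) ≤ Real.log ((n : ℝ) + 1) := by
          refine Real.log_le_log (by positivity) ?_
          push_cast
          linarith
        calc s.num (T k) (N k + 1) ≤ w k * s.num I₀ (N k + 1) := hT k _ (by omega)
          _ ≤ w k * (C * (((N k + 1 : ℕ) : ℝ) ^ (-a) *
              (1 + Real.log ((N k + 1 : ℕ) : ℝ)) ^ b)) := by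
            have := (hw0 k).le
            gcongr
            exact hCI _ (by omega)
          _ ≤ w k * (C * ((n * v k / V) ^ (-a) * (1 + Real.log (n + 1)) ^ b)) := by
            have := (hw0 k).le
            gcongr
          _ = C * V ^ a * (w k * v k ^ (-a)) *
              ((n : ℝ) ^ (-a) * (1 + Real.log (n + 1)) ^ b) := by
            rw [Real.div_rpow (by positivity) hV0.le, Real.mul_rpow hn0.le hvk.le,
              Real.rpow_neg hV0.le a, div_inv_eq_mul]
            ring
          _ = _ := by rw [hvw]
      calc s.num (∑ k ∈ F, T k) (n + 1)
          ≤ s.num (∑ k ∈ F, T k) (∑ k ∈ F, N k + 1) := s.num_le_num _ (by omega) (by omega)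
        _ ≤ ∑ k ∈ F, s.num (T k) (N k + 1) := PseudoSNumber.num_finset_sum_le hs F T N
        _ ≤ ∑ k ∈ F, C * V ^ a * v k * ((n : ℝ) ^ (-a) * (1 + Real.log (n + 1)) ^ b) :=
          Finset.sum_le_sum hterm
        _ = C * V ^ a * (∑ k ∈ F, v k) * ((n : ℝ) ^ (-a) * (1 + Real.log (n + 1)) ^ b) := by
          rw [← Finset.sum_mul, ← Finset.mul_sum]
        _ ≤ _ := by
          gcongr
          exact hFV F
    -- The finite-sum bound does not depend on `F`, so the remainder only has to vanish in norm, via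
    -- `s_n(S+T) ≤ s_n(S) + ‖T‖`.
    have hlim : Tendsto (fun F : Finset ι =>
        C * V ^ a * V * ((n : ℝ) ^ (-a) * (1 + Real.log (n + 1)) ^ b) + ‖S - ∑ k ∈ F, T k‖)
        atTop (nhds (C * V ^ a * V * ((n : ℝ) ^ (-a) * (1 + Real.log (n + 1)) ^ b) + 0)) := by
      refine tendsto_const_nhds.add ?_
      have h : Tendsto (fun F : Finset ι => S - ∑ k ∈ F, T k) atTop (nhds (S - S)) :=
        tendsto_const_nhds.sub hS
      simpa using h.norm
    rw [add_zero] at hlim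
    refine ge_of_tendsto' hlim fun F => ?_
    have h := s.num_add_le (∑ k ∈ F, T k) (S - ∑ k ∈ F, T k) (n + 1) (by omega)
    rw [add_sub_cancel] at h
    linarith [hfin F]
  -- The factor `2^a` pays for passing from `m` to `m + 1 ≤ 2m`, and `3^b` for `1 + log n ≤ 3 log
  -- n`, valid for `n ≥ 2` as `log 2 ≥ 1/2`.
  refine IsBigO.of_bound (C * V ^ a * V * (2 ^ a * 3 ^ b)) ?_
  filter_upwards [eventually_ge_atTop 2] with n hn
  have hn2 : (2 : ℝ) ≤ n := by exact_mod_cast hn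
  have hlog : 0 ≤ Real.log n := Real.log_nonneg (by linarith)
  rw [Real.norm_of_nonneg (s.num_nonneg S n (by omega)), Real.norm_of_nonneg (by positivity)]
  obtain ⟨m, rfl⟩ : ∃ m, n = m + 1 := ⟨n - 1, by omega⟩
  have hm : 1 ≤ m := by omega
  have hm' : (1 : ℝ) ≤ m := by exact_mod_cast hm
  refine (key m hm).trans ?_
  rw [mul_assoc]
  push_cast at hn2 hlog ⊢
  have h1 : (m : ℝ) ^ (-a) ≤ 2 ^ a * ((m : ℝ) + 1) ^ (-a) := by
    have h2 : (m : ℝ) ^ (-a) ≤ (((m : ℝ) + 1) / 2) ^ (-a) :=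
      Real.rpow_le_rpow_of_nonpos (by linarith) (by linarith) (by linarith)
    refine h2.trans (le_of_eq ?_)
    rw [Real.div_rpow (by positivity) (by norm_num), Real.rpow_neg (by norm_num : (0 : ℝ) ≤ 2) a,
      div_inv_eq_mul, mul_comm]
  have h3 : (1 + Real.log ((m : ℝ) + 1)) ^ b ≤ 3 ^ b * Real.log ((m : ℝ) + 1) ^ b := by
    rw [← Real.mul_rpow (by norm_num) hlog]
    gcongr
    have h4 : Real.log 2 ≤ Real.log ((m : ℝ) + 1) := Real.log_le_log (by norm_num) hn2
    have := Real.log_two_gt_d9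
    linarith
  calc C * V ^ a * (V * ((m : ℝ) ^ (-a) * (1 + Real.log (m + 1)) ^ b))
      ≤ C * V ^ a * (V * ((2 ^ a * ((m : ℝ) + 1) ^ (-a)) *
        (3 ^ b * Real.log ((m : ℝ) + 1) ^ b))) := by gcongr
    _ = _ := by ring

end SNumbers

/-! ### Operators into finite `ℓ_p`-sums. -/

/-- Assembling finitely many operators into an operator with values in an `ℓ_p`-sum. -/
theorem exists_piLp_lift (𝕜 : Type) [RCLike 𝕜] (p : ℝ≥0∞) [Fact (1 ≤ p)] (κ : Type) [Fintype κ]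
    (X Y : Type) [NormedAddCommGroup X] [NormedSpace 𝕜 X] [NormedAddCommGroup Y]
    [NormedSpace 𝕜 Y] :
    ∃ N : ℝ, 0 ≤ N ∧ ∀ (L : κ → X →L[𝕜] Y) (K : ℝ), 0 ≤ K → (∀ r, ‖L r‖ ≤ K) →
      ∃ T : X →L[𝕜] PiLp p (fun _ : κ => Y), (∀ x r, T x r = L r x) ∧ ‖T‖ ≤ N * K := by
  -- The norm of the identity from the sup-normed product to the `ℓ_p`-sum. It is fixed before the
  -- operators are given, which later makes the constants uniform over tiles.
  refine ⟨‖((PiLp.continuousLinearEquiv p 𝕜 (fun _ : κ => Y)).symm :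
    (κ → Y) →L[𝕜] PiLp p (fun _ : κ => Y))‖, norm_nonneg _, fun L K hK hL => ?_⟩
  refine ⟨((PiLp.continuousLinearEquiv p 𝕜 (fun _ : κ => Y)).symm :
    (κ → Y) →L[𝕜] PiLp p (fun _ : κ => Y)).comp (ContinuousLinearMap.pi L), fun x r => rfl, ?_⟩
  refine (ContinuousLinearMap.opNorm_comp_le _ _).trans ?_
  gcongr
  exact ContinuousLinearMap.norm_pi_le_of_le hL hK

/-- Assembling finite sums of operators into an operator with values in an `ℓ_p`-sum, with a
bound on its norm. -/
theorem exists_piLp_sum_lift (𝕜 : Type) [RCLike 𝕜] (p : ℝ≥0∞) [Fact (1 ≤ p)] (κ : Type)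
    [Fintype κ] (X Y Z : Type) [NormedAddCommGroup X] [NormedSpace 𝕜 X] [NormedAddCommGroup Y]
    [NormedSpace 𝕜 Y] [NormedAddCommGroup Z] [NormedSpace 𝕜 Z] :
    ∃ N : ℝ, 0 ≤ N ∧ ∀ (P : κ → X →L[𝕜] Y) (ι : κ → Type) (_ : ∀ r, Fintype (ι r))
      (V : ∀ r, ι r → Y →L[𝕜] Z) (l : ∀ r, ι r → κ) (M : ∀ r, ι r → ℝ) (t : ℝ),
      (∀ r, ‖P r‖ ≤ 1) → 0 ≤ t → (∀ r j, 0 ≤ M r j) → (∀ r j, ‖V r j‖ ≤ M r j * t) →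
      ∃ T : X →L[𝕜] PiLp p (fun _ : κ => Z),
        (∀ x r, T x r = ∑ j, V r j (P (l r j) x)) ∧ ‖T‖ ≤ N * ((∑ r, ∑ j, M r j) * t) := by
  obtain ⟨N, hN0, hN⟩ := exists_piLp_lift 𝕜 p κ X Z
  refine ⟨N, hN0, fun P ι _ V l M t hP ht hM hV => ?_⟩
  have hMs : ∀ r, 0 ≤ ∑ j, M r j := fun r => Finset.sum_nonneg fun j _ => hM r j
  obtain ⟨T, hT, hTn⟩ := hN (fun r => ∑ j, (V r j).comp (P (l r j))) ((∑ r, ∑ j, M r j) * t)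
    (mul_nonneg (Finset.sum_nonneg fun r _ => hMs r) ht) fun r => by
      calc ‖∑ j, (V r j).comp (P (l r j))‖ ≤ ∑ j, ‖(V r j).comp (P (l r j))‖ := norm_sum_le _ _
        _ ≤ ∑ j, M r j * t := by
          refine Finset.sum_le_sum fun j _ => ?_
          refine (ContinuousLinearMap.opNorm_comp_le _ _).trans ?_
          exact (mul_le_of_le_one_right (norm_nonneg _) (hP _)).trans (hV r j)
        _ = (∑ j, M r j) * t := by rw [Finset.sum_mul]
        _ ≤ _ := by
          gcongr
          exact Finset.single_le_sum (f := fun r => ∑ j, M r j) (fun r _ => hMs r)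
            (Finset.mem_univ r)
  exact ⟨T, fun x r => by simp [hT], hTn⟩

theorem coeFn_finset_sum_Lp {𝕜 : Type} [RCLike 𝕜] {p : ℝ≥0∞} {E ι : Type*} [MeasurableSpace E] {μ : Measure E} (s : Finset ι)
    (f : ι → Lp 𝕜 p μ) : (∑ j ∈ s, f j : Lp 𝕜 p μ) =ᵐ[μ] ∑ j ∈ s, (f j : E → 𝕜) := by
  classical
  induction s using Finset.induction_on with
  | empty => simpa using Lp.coeFn_zero 𝕜 p μ
  | insert j s hj ih =>
    rw [Finset.sum_insert hj, Finset.sum_insert hj]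
    exact (Lp.coeFn_add _ _).trans (EventuallyEq.rfl.add ih)

/-! ### Periodic extension and the lower bound; cutoff and periodization. -/

section Operators

variable {𝕜 : Type} [RCLike 𝕜] {d α : ℕ} {p q : ℝ≥0∞} [Fact (1 ≤ p)] [Fact (1 ≤ q)]

theorem ae_volume_of_ae_gaussianMeasure {P : (Fin d → ℝ) → Prop}
    (h : ∀ᵐ x ∂(gaussianMeasure d), P x) : ∀ᵐ x, P x :=
  (locallyControlled_gaussianMeasure d).ae_comp h

theorem ae_cubeMeasure_of_ae_gaussianMeasure {P : (Fin d → ℝ) → Prop}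
    (h : ∀ᵐ x ∂(gaussianMeasure d), P x) : ∀ᵐ x ∂(cubeMeasure d), P x :=
  ae_restrict_of_ae (ae_volume_of_ae_gaussianMeasure h)

theorem coeFn_gaussianEmbedding (hqp : q ≤ p) (F : gaussianSobolev 𝕜 d α p) :
    (gaussianEmbedding 𝕜 d α p q hqp F : (Fin d → ℝ) → 𝕜) = F.1 0 := rfl

theorem coeFn_periodicEmbedding (hqp : q ≤ p) (F : periodicSobolev 𝕜 d α p) :
    ((periodicEmbedding 𝕜 d α p q hqp F).1 : (Fin d → ℝ) → 𝕜) = F.1 0 := rfl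

/-- Periodic extension, as an operator into the Gaussian Sobolev space. -/
theorem exists_periodicExtension (hp : p ≠ ∞) :
    ∃ A : periodicSobolev 𝕜 d α p →L[𝕜] gaussianSobolev 𝕜 d α p,
      ∀ F, (A F).1 0 =ᵐ[gaussianMeasure d] fun x => F.1 0 (wrap x) := by
  obtain ⟨c, hc0, hc⟩ := exists_gaussianMeasure_map_wrap_le d
  obtain ⟨W, hW, hWn⟩ := exists_weightedComp 𝕜 hp (m := fun _ => 1) (s := Set.univ) (M := 1)
    measurable_const measurable_wrap MeasurableSet.univ (by simp) zero_le_one (by simp) hc0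
    (by rwa [Measure.restrict_univ])
  obtain ⟨N, -, hN⟩ := exists_piLp_lift 𝕜 p (Fin d → Fin (α + 1)) (periodicSobolev 𝕜 d α p)
    (Lp 𝕜 p (gaussianMeasure d))
  let L : (Fin d → Fin (α + 1)) → periodicSobolev 𝕜 d α p →L[𝕜] Lp 𝕜 p (gaussianMeasure d) :=
    fun r => W.comp ((PiLp.proj p (fun _ : Fin d → Fin (α + 1) => Lp 𝕜 p (cubeMeasure d)) r).comp
      (periodicSobolev 𝕜 d α p).subtypeL)
  obtain ⟨T, hT, -⟩ := hN L (∑ r, ‖L r‖) (Finset.sum_nonneg fun r _ => norm_nonneg (L r))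
    fun r => Finset.single_le_sum (f := fun r => ‖L r‖) (fun r _ => norm_nonneg (L r))
      (Finset.mem_univ r)
  have hT' : ∀ F r, T F r =ᵐ[gaussianMeasure d] fun x => F.1 r (wrap x) := fun F r => by
    rw [hT]
    exact (hW (F.1 r)).trans (Eventually.of_forall fun x => one_smul _ _)
  refine ⟨T.codRestrict (gaussianSobolev 𝕜 d α p) fun F r => ?_, fun F => hT' F 0⟩
  -- Weak derivatives are tested against Lebesgue measure, whose null sets include all `γ`-null
  -- sets.
  have ae := fun r => ae_volume_of_ae_gaussianMeasure (hT' F r)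
  exact (mem_periodicSobolev_iff.1 F.2 r).congr_ae
    ((ae 0).mono fun x hx => hx.symm) ((ae r).mono fun x hx => hx.symm)

/-- Extend periodically, embed, and restrict to the cube. Restriction lands in the full `L_q` of the
cube, which is why the isometric inclusion of `periodicLp` appears on the left. -/
theorem exists_periodicEmbedding_factorization (hp : p ≠ ∞) (hq : q ≠ ∞) (hqp : q ≤ p) :
    ∃ (A : periodicSobolev 𝕜 d α p →L[𝕜] gaussianSobolev 𝕜 d α p)
      (B : Lp 𝕜 q (gaussianMeasure d) →L[𝕜] Lp 𝕜 q (cubeMeasure d)),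
      (periodicLp 𝕜 d q).subtypeₗᵢ.toContinuousLinearMap.comp (periodicEmbedding 𝕜 d α p q hqp) =
        B.comp ((gaussianEmbedding 𝕜 d α p q hqp).comp A) := by
  obtain ⟨A, hA⟩ := exists_periodicExtension (𝕜 := 𝕜) (d := d) (α := α) hp
  -- The lower density bound with centre `0` and `ε = 1`; the trivial shift by `0` lets the
  -- translated-cube estimate apply.
  obtain ⟨c, hc0, hc⟩ : ∃ c : ℝ, 0 < c ∧ ∀ z ∈ unitCube d, c ≤ gaussianDensity d (0 + z) :=
    ⟨_, by have := Real.pi_pos; positivity, fun z hz => le_gaussianDensity_add one_pos 0 z hz⟩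
  have hB := cubeMeasure_map_add_le hc0 hc
  obtain ⟨B, hB, -⟩ := exists_weightedComp 𝕜 hq (m := fun _ => 1)
    (u := fun x : Fin d → ℝ => x + 0) (s := Set.univ) (M := 1)
    measurable_const (measurable_id.add_const 0) MeasurableSet.univ (by simp) zero_le_one
    (by simp) (inv_nonneg.2 hc0.le) (by rw [Measure.restrict_univ]; exact hB)
  refine ⟨A, B, ContinuousLinearMap.ext fun F => Lp.ext ?_⟩
  have h1 := hB (gaussianEmbedding 𝕜 d α p q hqp (A F))
  have h2 := ae_cubeMeasure_of_ae_gaussianMeasure (hA F)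
  change (F.1 0 : (Fin d → ℝ) → 𝕜) =ᵐ[cubeMeasure d] B (gaussianEmbedding 𝕜 d α p q hqp (A F))
  filter_upwards [h1, h2, wrap_ae_eq (d := d)] with x h1 h2 h3
  rw [h1, coeFn_gaussianEmbedding]
  simp [h2, h3]

theorem PseudoSNumber.IsWeaklyInjective.isBigO_gaussianEmbedding (hp : p ≠ ∞) (hq : q ≠ ∞)
    (hqp : q ≤ p) {s : PseudoSNumber 𝕜} (hs : s.IsWeaklyInjective) :
    (fun n : ℕ => s.num (periodicEmbedding 𝕜 d α p q hqp) n)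
      =O[atTop] fun n : ℕ => s.num (gaussianEmbedding 𝕜 d α p q hqp) n := by
  obtain ⟨A, B, hAB⟩ := exists_periodicEmbedding_factorization (𝕜 := 𝕜) (d := d) (α := α) hp hq hqp
  obtain ⟨_, C, _, hC, h⟩ := hs (periodicEmbedding 𝕜 d α p q hqp) (periodicLp 𝕜 d q).subtypeₗᵢ
  refine IsBigO.of_bound (C * (‖B‖ * ‖A‖)) ?_
  filter_upwards [eventually_ge_atTop 1] with n hn
  rw [Real.norm_of_nonneg (s.num_nonneg _ n hn), Real.norm_of_nonneg (s.num_nonneg _ n hn)]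
  have h1 := (h n hn).2
  rw [hAB] at h1
  have h2 := mul_le_mul_of_nonneg_left
    (s.num_comp_le B (gaussianEmbedding 𝕜 d α p q hqp) A n hn) hC.le
  linarith

theorem support_sum_smul_subset {ι : Type*} [Fintype ι] {c : ι → (Fin d → ℝ) → ℝ}
    {S : Set (Fin d → ℝ)} (hc : ∀ j, tsupport (c j) ⊆ S) (f : ι → (Fin d → ℝ) → 𝕜) :
    Function.support (fun x => ∑ j, c j x • f j x) ⊆ S := by
  intro x hx
  by_contra hxS
  refine hx (Finset.sum_eq_zero fun j _ => ?_)
  rw [image_eq_zero_of_notMem_tsupport fun h => hxS (hc j h), zero_smul]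

/-- Translating, cutting off and periodizing, as an operator into the periodic Sobolev space. -/
theorem exists_cutoffPeriodization (hp : p ≠ ∞) {φ : (Fin d → ℝ) → ℝ}
    (hφ : ContDiff ℝ (⊤ : ℕ∞) φ ∧ HasCompactSupport φ)
    (hφs : tsupport φ ⊆ Metric.ball 0 (1 / 2)) :
    ∃ N : ℝ, 0 ≤ N ∧ ∀ (v : Fin d → ℝ) (c : ℝ), 0 < c →
      (∀ z ∈ unitCube d, c ≤ gaussianDensity d (v + z)) →
      ∃ A : gaussianSobolev 𝕜 d α p →L[𝕜] periodicSobolev 𝕜 d α p,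
        ‖A‖ ≤ N * c⁻¹ ^ (1 / p.toReal) ∧
        ∀ F, (A F).1 0 =ᵐ[cubeMeasure d] fun x => φ x • F.1 0 (x + v) := by
  classical
  obtain ⟨N, hN0, hN⟩ := exists_piLp_sum_lift 𝕜 p (Fin d → Fin (α + 1))
    (gaussianSobolev 𝕜 d α p) (Lp 𝕜 p (gaussianMeasure d)) (Lp 𝕜 p (cubeMeasure d))
  -- Leibniz is applied to the fixed cutoff; the translation sits in the function. Coefficients and
  -- their bounds are therefore independent of `v`.
  have leib := fun r : Fin d → Fin (α + 1) => exists_leibniz (𝕜 := 𝕜) hφ (fun i => (r i : ℕ))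
  choose ι hι c l hc hcs hl hc0 hw using leib
  have hM : ∀ r j, ∃ M : ℝ, 0 ≤ M ∧ ∀ x, |c r j x| ≤ M := by
    intro r j
    obtain ⟨M, hM⟩ := (hc r j).2.exists_bound_of_continuous (hc r j).1.continuous
    exact ⟨M, (norm_nonneg _).trans (hM 0), hM⟩
  choose M hM0 hM using hM
  refine ⟨N * ∑ r, ∑ j, M r j, mul_nonneg hN0 (Finset.sum_nonneg fun r _ =>
    Finset.sum_nonneg fun j _ => hM0 r j), fun v m hm hmg => ?_⟩
  have hmap := cubeMeasure_map_add_le hm hmg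
  have hV := fun r j => exists_weightedComp 𝕜 hp (m := c r j) (s := Set.univ)
    (hc r j).1.continuous.measurable (measurable_id.add_const v) MeasurableSet.univ (by simp)
    (hM0 r j) (hM r j) (inv_nonneg.2 hm.le) (by rw [Measure.restrict_univ]; exact hmap)
  choose V hV hVn using hV
  -- `Fin.ofNat` reduces modulo `α + 1`, so values beyond `α` are meaningless; only multi-indices
  -- below some `r` matter, where `lift` is faithful.
  let lift : (Fin d → ℕ) → Fin d → Fin (α + 1) := fun l i => Fin.ofNat (α + 1) (l i)
  have hlift : ∀ (r : Fin d → Fin (α + 1)) (l : Fin d → ℕ), l ≤ (fun i => (r i : ℕ)) →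
      (fun i => (lift l i : ℕ)) = l := by
    intro r l hl
    funext i
    exact Nat.mod_eq_of_lt ((hl i).trans_lt (r i).isLt)
  have hlift0 : lift 0 = 0 := rfl
  let P : (Fin d → Fin (α + 1)) → gaussianSobolev 𝕜 d α p →L[𝕜] Lp 𝕜 p (gaussianMeasure d) :=
    fun r => (PiLp.proj p (fun _ : Fin d → Fin (α + 1) => Lp 𝕜 p (gaussianMeasure d)) r).comp
      (gaussianSobolev 𝕜 d α p).subtypeL
  have hP : ∀ r, ‖P r‖ ≤ 1 := fun r =>
    ContinuousLinearMap.opNorm_le_bound _ zero_le_one fun F => by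
      rw [one_mul]
      exact PiLp.norm_apply_le F.1 r
  obtain ⟨T, hT, hTn⟩ := hN P ι hι V (fun r j => lift (l r j)) M (m⁻¹ ^ (1 / p.toReal)) hP
    (by positivity) hM0 hVn
  let G : gaussianSobolev 𝕜 d α p → (Fin d → ℕ) → (Fin d → ℝ) → 𝕜 :=
    fun F l x => F.1 (lift l) (x + v)
  have hTG : ∀ F r, T F r =ᵐ[cubeMeasure d] fun x => ∑ j, c r j x • G F (l r j) x := by
    intro F r
    rw [hT]
    have h1 := ae_all_iff.2 fun j => hV r j (P (lift (l r j)) F)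
    filter_upwards [coeFn_finset_sum_Lp Finset.univ fun j => V r j (P (lift (l r j)) F), h1]
      with x hx h1
    rw [hx, Finset.sum_apply]
    exact Finset.sum_congr rfl fun j _ => h1 j
  have hT0 : ∀ F, T F 0 =ᵐ[cubeMeasure d] fun x => φ x • F.1 0 (x + v) := fun F =>
    (hTG F 0).trans (Eventually.of_forall fun x => hc0 0 rfl (G F) x)
  refine ⟨T.codRestrict (periodicSobolev 𝕜 d α p) fun F => ?_, ?_, hT0⟩
  · have hss : ∀ r, Function.support (fun x => ∑ j, c r j x • G F (l r j) x) ⊆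
        Metric.ball 0 (1 / 2) := fun r =>
      support_sum_smul_subset (fun j => (hcs r j).trans hφs) _
    refine ⟨fun r x => ∑ j, c r j (wrap x) • G F (l r j) (wrap x),
      fun r =>
        isOnePeriodic_comp_wrap (fun x => ∑ j, c r j x • G F (l r j) x), fun r => ?_, fun r => ?_⟩
    · filter_upwards [hTG F r, wrap_ae_eq (d := d)] with x h1 h2
      rw [h2, h1]
    · have hwr := hw r (G F) fun l hl => by
        have := (F.2 (lift l)).comp_add v
        rwa [hlift r l hl] at this
      -- The periodic family at index `0` is the Leibniz sum for order zero, which must be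
      -- identified with the plain product.
      have e : (fun x => φ x • G F 0 x) = fun x => ∑ j, c 0 j x • G F (l 0 j) x := by
        funext x
        exact (hc0 0 rfl (G F) x).symm
      rw [e] at hwr
      exact hwr.comp_wrap (hss 0) (hss r)
  · refine (ContinuousLinearMap.opNorm_le_bound _ (norm_nonneg T) fun F => T.le_opNorm F).trans ?_
    rw [mul_assoc]
    exact hTn

end Operators

/-! ### Localization to tiles and the upper bound. -/

/-- The cube of side `1/2` centred at `k/2`. -/
def halfTile {d : ℕ} (k : Fin d → ℤ) : Set (Fin d → ℝ) :=
  {x | ∀ i, ⌊2 * x i + 1 / 2⌋ = k i}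

/-- The centre `k/2` of `halfTile k`. -/
noncomputable def halfPoint {d : ℕ} (k : Fin d → ℤ) : Fin d → ℝ := fun i => (k i : ℝ) / 2

theorem summable_comp_comp {𝕜 ι X X₀ Y₀ Y : Type*} [RCLike 𝕜] [NormedAddCommGroup X]
    [NormedSpace 𝕜 X] [NormedAddCommGroup X₀] [NormedSpace 𝕜 X₀] [NormedAddCommGroup Y₀]
    [NormedSpace 𝕜 Y₀] [NormedAddCommGroup Y] [NormedSpace 𝕜 Y] [CompleteSpace Y]
    {B : ι → Y₀ →L[𝕜] Y} {I : X₀ →L[𝕜] Y₀} {A : ι → X →L[𝕜] X₀} {c : ι → ℝ}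
    (h : ∀ k, ‖B k‖ * ‖A k‖ ≤ c k) (hc : Summable c) :
    Summable fun k => (B k).comp (I.comp (A k)) :=
  Summable.of_norm_bounded (hc.mul_right ‖I‖) fun k =>
    calc ‖(B k).comp (I.comp (A k))‖ ≤ ‖B k‖ * (‖I‖ * ‖A k‖) :=
          (ContinuousLinearMap.opNorm_comp_le _ _).trans
            (mul_le_mul_of_nonneg_left (ContinuousLinearMap.opNorm_comp_le _ _) (norm_nonneg _))
      _ = ‖B k‖ * ‖A k‖ * ‖I‖ := by ring
      _ ≤ _ := mul_le_mul_of_nonneg_right (h k) (norm_nonneg _)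

section Upper

variable {𝕜 : Type} [RCLike 𝕜] {d α : ℕ} {p q : ℝ≥0∞} [Fact (1 ≤ p)] [Fact (1 ≤ q)]

theorem measurableSet_halfTile (k : Fin d → ℤ) : MeasurableSet (halfTile k) := by
  simp only [halfTile, Set.ofPred_forall]
  exact MeasurableSet.iInter fun i => (Int.measurable_floor.comp
    (((measurable_pi_apply i).const_mul 2).add_const _)) (measurableSet_singleton _)

theorem abs_sub_halfPoint_le {k : Fin d → ℤ} {x : Fin d → ℝ} (hx : x ∈ halfTile k) (i : Fin d) :
    |(x + -halfPoint k) i| ≤ 1 / 4 := by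
  have h := Int.floor_eq_iff.1 (hx i)
  simp only [Pi.add_apply, Pi.neg_apply, halfPoint]
  rw [abs_le]
  constructor <;> linarith [h.1, h.2]

theorem sub_halfPoint_mem_unitCube {k : Fin d → ℤ} {x : Fin d → ℝ} (hx : x ∈ halfTile k) :
    x + -halfPoint k ∈ unitCube d :=
  mem_unitCube_iff.2 fun i => (abs_sub_halfPoint_le hx i).trans (by norm_num)

theorem indicator_halfTile_eq_zero {j k : Fin d → ℤ} (hjk : j ≠ k) (x : Fin d → ℝ) :
    (halfTile j).indicator (1 : (Fin d → ℝ) → ℝ) x *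
      (halfTile k).indicator (1 : (Fin d → ℝ) → ℝ) x = 0 := by
  by_contra hne
  have h1 := Set.mem_of_indicator_ne_zero (left_ne_zero_of_mul hne)
  have h2 := Set.mem_of_indicator_ne_zero (right_ne_zero_of_mul hne)
  exact hjk (funext fun i => (h1 i).symm.trans (h2 i))

theorem abs_indicator_one_le {E : Type*} (Q : Set E) (x : E) :
    |Q.indicator (1 : E → ℝ) x| ≤ 1 := by
  by_cases hx : x ∈ Q <;> simp [hx]

/-- Multiplication by an indicator function, as an operator on `L_q(γ)`. -/
theorem exists_indicatorMul (hq : q ≠ ∞) {Q : Set (Fin d → ℝ)} (hQ : MeasurableSet Q) :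
    ∃ P : Lp 𝕜 q (gaussianMeasure d) →L[𝕜] Lp 𝕜 q (gaussianMeasure d),
      ∀ f, P f =ᵐ[gaussianMeasure d] fun x => Q.indicator (1 : (Fin d → ℝ) → ℝ) x • f x := by
  obtain ⟨P, hP, -⟩ := exists_weightedComp 𝕜 hq (μ := gaussianMeasure d) (ν := gaussianMeasure d)
    (m := Q.indicator 1) (u := id) (s := Set.univ) (M := 1) (c := 1)
    (measurable_one.indicator hQ) measurable_id MeasurableSet.univ (by simp) zero_le_one
    (abs_indicator_one_le Q) zero_le_one (by simp)
  exact ⟨P, hP⟩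

/-- The localization of the Gaussian embedding to a tile factors through the periodic
embedding. -/
theorem exists_localization (𝕜 : Type) [RCLike 𝕜] (d α : ℕ) (hp : p ≠ ∞) (hq : q ≠ ∞)
    (hqp : q ≤ p) :
    ∃ N : ℝ, 0 ≤ N ∧ ∀ (k : Fin d → ℤ) (c C : ℝ), 0 < c →
      (∀ z ∈ unitCube d, c ≤ gaussianDensity d (halfPoint k + z)) →
      (∀ z ∈ unitCube d, gaussianDensity d (halfPoint k + z) ≤ C) →
      ∃ (A : gaussianSobolev 𝕜 d α p →L[𝕜] periodicSobolev 𝕜 d α p)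
        (B : periodicLp 𝕜 d q →L[𝕜] Lp 𝕜 q (gaussianMeasure d)),
        ‖B‖ * ‖A‖ ≤ N * (c⁻¹ ^ (1 / p.toReal) * C ^ (1 / q.toReal)) ∧
        ∀ F, B.comp ((periodicEmbedding 𝕜 d α p q hqp).comp A) F =ᵐ[gaussianMeasure d]
          fun x => (halfTile k).indicator (1 : (Fin d → ℝ) → ℝ) x •
            gaussianEmbedding 𝕜 d α p q hqp F x := by
  -- Equal to `1` on the sup-ball of radius 1/4, which contains the centred tile, and supported
  -- within radius 3/8. Tiles of side 1/2 leave room to vanish before the boundary of the unit cube.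
  let φ : ContDiffBump (0 : Fin d → ℝ) := ⟨1 / 4, 3 / 8, by norm_num, by norm_num⟩
  have hφs : tsupport φ ⊆ Metric.ball 0 (1 / 2) := by
    rw [φ.tsupport_eq]
    exact Metric.closedBall_subset_ball (by norm_num)
  obtain ⟨N, hN0, hN⟩ := exists_cutoffPeriodization (𝕜 := 𝕜) (d := d) (α := α) hp
    ⟨φ.contDiff, φ.hasCompactSupport⟩ hφs
  refine ⟨N, hN0, fun k c C hc0 hc hC => ?_⟩
  obtain ⟨A, hAn, hA⟩ := hN (halfPoint k) c hc0 hc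
  have hQ := measurableSet_halfTile k
  have hC0 : 0 ≤ C := by
    have h0 : (0 : Fin d → ℝ) ∈ unitCube d := mem_unitCube_iff.2 fun i => by simp
    exact (gaussianDensity_pos d _).le.trans (hC 0 h0)
  have hmap := gaussianMeasure_map_sub_le hQ (fun x hx => sub_halfPoint_mem_unitCube hx) hC
  have hu : Measurable fun x : Fin d → ℝ => x + -halfPoint k := measurable_id.add_const _
  obtain ⟨W, hW, hWn⟩ := exists_weightedComp 𝕜 hq (m := (halfTile k).indicator 1)
    (measurable_one.indicator hQ) hu hQ (fun x hx => by simp [hx]) zero_le_one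
    (abs_indicator_one_le _) hC0 hmap
  refine ⟨A, W.comp (periodicLp 𝕜 d q).subtypeL, ?_, fun F => ?_⟩
  · have h1 : ‖W.comp (periodicLp 𝕜 d q).subtypeL‖ ≤ C ^ (1 / q.toReal) := by
      refine ContinuousLinearMap.opNorm_le_bound _ (by positivity) fun f => ?_
      refine (W.le_opNorm _).trans ?_
      rw [one_mul] at hWn
      exact mul_le_mul_of_nonneg_right hWn (norm_nonneg _)
    calc ‖W.comp (periodicLp 𝕜 d q).subtypeL‖ * ‖A‖
        ≤ C ^ (1 / q.toReal) * (N * c⁻¹ ^ (1 / p.toReal)) :=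
          mul_le_mul h1 hAn (norm_nonneg A) (by positivity)
      _ = _ := by ring
  · have h1 := hW (periodicEmbedding 𝕜 d α p q hqp (A F)).1
    -- The formula for `A F` holds almost everywhere on the cube; `hmap` transports it to `γ`-almost
    -- every point of the tile.
    have h2 : ∀ᵐ y ∂(((gaussianMeasure d).restrict (halfTile k)).map fun x => x + -halfPoint k),
        (A F).1 0 y = φ y • F.1 0 (y + halfPoint k) :=
      (Measure.absolutelyContinuous_of_le_smul hmap) (hA F)
    have h3 := (ae_restrict_iff' hQ).1 (ae_of_ae_map hu.aemeasurable h2)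
    change W (periodicEmbedding 𝕜 d α p q hqp (A F)).1 =ᵐ[gaussianMeasure d] _
    filter_upwards [h1, h3] with x h1 h3
    rw [h1, coeFn_periodicEmbedding, coeFn_gaussianEmbedding]
    by_cases hx : x ∈ halfTile k
    · rw [h3 hx, φ.one_of_mem_closedBall, one_smul, neg_add_cancel_right]
      rw [mem_closedBall_zero_iff]
      exact (pi_norm_le_iff_of_nonneg (by norm_num [φ])).2 fun i => abs_sub_halfPoint_le hx i
    · simp [hx]

/-- An operator into `L_q(γ)` is the sum of its localizations to the tiles, provided that their
norms are summable. -/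
theorem hasSum_of_localization (hq : q ≠ ∞) {X : Type} [NormedAddCommGroup X] [NormedSpace 𝕜 X]
    {S : X →L[𝕜] Lp 𝕜 q (gaussianMeasure d)}
    {T : (Fin d → ℤ) → X →L[𝕜] Lp 𝕜 q (gaussianMeasure d)} (hT : Summable T)
    (hTS : ∀ k F, T k F =ᵐ[gaussianMeasure d]
      fun x => (halfTile k).indicator (1 : (Fin d → ℝ) → ℝ) x • S F x) : HasSum T S := by
  obtain ⟨R, hR⟩ := hT
  suffices h : R = S by rwa [h] at hR
  refine ContinuousLinearMap.ext fun F => Lp.ext ?_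
  have key : ∀ j : Fin d → ℤ, ∀ᵐ x ∂(gaussianMeasure d), x ∈ halfTile j → R F x = S F x := by
    intro j
    obtain ⟨P, hP⟩ := exists_indicatorMul (𝕜 := 𝕜) hq (measurableSet_halfTile j)
    have hRF : HasSum (fun k => T k F) (R F) :=
      (ContinuousLinearMap.apply 𝕜 (Lp 𝕜 q (gaussianMeasure d)) F).hasSum hR
    have h1 : HasSum (fun k => P (T k F)) (P (R F)) := P.hasSum hRF
    -- Multiplying by the indicator of tile `j` kills every other term, so uniqueness of sums
    -- identifies `R F` with `S F` on that tile. Countably many tiles cover the space.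
    have h2 : HasSum (fun k => P (T k F)) (P (T j F)) := by
      refine hasSum_single j fun k hk => Lp.ext ?_
      filter_upwards [hP (T k F), hTS k F, Lp.coeFn_zero 𝕜 q (gaussianMeasure d)] with x h1 h2 h3
      rw [h1, h2, h3, smul_smul, indicator_halfTile_eq_zero hk.symm, zero_smul, Pi.zero_apply]
    have h3 := h1.unique h2
    have h4 := hP (R F)
    rw [h3] at h4
    filter_upwards [h4, hP (T j F), hTS j F] with x h4 h5 h6 hx
    rw [h5, h6] at h4
    simpa [hx] using h4.symm
  filter_upwards [ae_all_iff.2 key] with x hx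
  exact hx (fun i => ⌊2 * x i + 1 / 2⌋) fun i => rfl

theorem inv_mul_exp_rpow_mul_rpow {K K' : ℝ} (hK : 0 < K) (hK' : 0 < K') (x y s t : ℝ) :
    (K * Real.exp x)⁻¹ ^ s * (K' * Real.exp y) ^ t =
      K⁻¹ ^ s * K' ^ t * Real.exp (y * t - x * s) := by
  rw [mul_inv, ← Real.exp_neg, Real.mul_rpow (by positivity) (by positivity),
    Real.mul_rpow (by positivity) (by positivity), ← Real.exp_mul, ← Real.exp_mul,
    show y * t - x * s = -x * s + y * t by ring, Real.exp_add]
  ring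

/-- The Gaussian embedding is a rapidly convergent sum of operators that factor through the
periodic embedding. -/
theorem exists_gaussianEmbedding_decomposition (𝕜 : Type) [RCLike 𝕜] (d α : ℕ) (hp : p ≠ ∞)
    (hqp : q < p) :
    ∃ (A : (Fin d → ℤ) → gaussianSobolev 𝕜 d α p →L[𝕜] periodicSobolev 𝕜 d α p)
      (B : (Fin d → ℤ) → periodicLp 𝕜 d q →L[𝕜] Lp 𝕜 q (gaussianMeasure d)) (C δ : ℝ),
      0 < C ∧ 0 < δ ∧
      (∀ k, ‖B k‖ * ‖A k‖ ≤ C * Real.exp (-δ * ∑ i, (k i : ℝ) ^ 2)) ∧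
      HasSum (fun k => (B k).comp ((periodicEmbedding 𝕜 d α p q hqp.le).comp (A k)))
        (gaussianEmbedding 𝕜 d α p q hqp.le) := by
  have hq : q ≠ ∞ := hqp.ne_top
  have hpi := Real.pi_pos
  have hq1 : 1 ≤ q.toReal := by
    simpa using ENNReal.toReal_mono hq (Fact.out : 1 ≤ q)
  have hqp' : q.toReal < p.toReal := (ENNReal.toReal_lt_toReal hq hp).2 hqp
  have hD : 0 < 1 / q.toReal - 1 / p.toReal :=
    sub_pos.2 (one_div_lt_one_div_of_lt (by linarith) hqp')
  have hE : 0 < 1 / q.toReal + 1 / p.toReal := by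
    have : 0 < p.toReal := by linarith
    positivity
  -- Chosen so that the two Young losses together consume exactly half of the gap `1/q - 1/p`.
  obtain ⟨ε, hε, hεD⟩ : ∃ ε : ℝ, 0 < ε ∧ ε * (1 / q.toReal + 1 / p.toReal) =
      (1 / q.toReal - 1 / p.toReal) / 2 :=
    ⟨(1 / q.toReal - 1 / p.toReal) / 2 / (1 / q.toReal + 1 / p.toReal), by positivity,
      div_mul_cancel₀ _ hE.ne'⟩
  obtain ⟨N, hN0, hN⟩ := exists_localization (p := p) (q := q) 𝕜 d α hp hq hqp.le
  obtain ⟨K, hK, hKg⟩ : ∃ K : ℝ, 0 < K ∧ ∀ v, ∀ z ∈ unitCube d,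
      K * Real.exp (-((1 + ε) / 2) * ∑ i, v i ^ 2) ≤ gaussianDensity d (v + z) :=
    ⟨_, by positivity, le_gaussianDensity_add hε⟩
  obtain ⟨K', hK', hKg'⟩ : ∃ K : ℝ, 0 < K ∧ ∀ v, ∀ z ∈ unitCube d,
      gaussianDensity d (v + z) ≤ K * Real.exp (-((1 - ε) / 2) * ∑ i, v i ^ 2) :=
    ⟨_, by positivity, gaussianDensity_add_le hε⟩
  have hloc := fun k : Fin d → ℤ => hN k _ _ (mul_pos hK (Real.exp_pos _))
    (hKg (halfPoint k)) (hKg' (halfPoint k))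
  choose A B hAB hTF using hloc
  -- One factor 1/2 comes from the Gaussian exponent, one from the half of the gap that is left, and
  -- 1/4 from `|k/2|² = |k|²/4`.
  let δ := (1 / q.toReal - 1 / p.toReal) / 16
  have hδ : 0 < δ := by positivity
  -- `N + 1` instead of `N` makes the constant strictly positive, as the weights in the summation
  -- lemma must be.
  have hbound : ∀ k, ‖B k‖ * ‖A k‖ ≤ (N + 1) * (K⁻¹ ^ (1 / p.toReal) * K' ^ (1 / q.toReal)) *
      Real.exp (-δ * ∑ i, (k i : ℝ) ^ 2) := by
    intro k
    refine (hAB k).trans ?_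
    rw [inv_mul_exp_rpow_mul_rpow hK hK']
    have e : -((1 - ε) / 2) * (∑ i, halfPoint k i ^ 2) * (1 / q.toReal) -
        -((1 + ε) / 2) * (∑ i, halfPoint k i ^ 2) * (1 / p.toReal) =
        -δ * ∑ i, (k i : ℝ) ^ 2 := by
      have h : ∑ i, halfPoint k i ^ 2 = (∑ i, (k i : ℝ) ^ 2) / 4 := by
        rw [Finset.sum_div]
        exact Finset.sum_congr rfl fun i _ => by rw [halfPoint]; ring
      rw [h]
      simp only [δ]
      linear_combination (∑ i, (k i : ℝ) ^ 2) / 8 * hεD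
    rw [e, mul_assoc (N + 1)]
    gcongr
    linarith
  have hsum : Summable fun k =>
      (B k).comp ((periodicEmbedding 𝕜 d α p q hqp.le).comp (A k)) :=
    summable_comp_comp hbound ((summable_exp_neg_mul_sum_sq d hδ).mul_left _)
  exact ⟨A, B, (N + 1) * (K⁻¹ ^ (1 / p.toReal) * K' ^ (1 / q.toReal)), δ, by positivity, hδ,
    hbound, hasSum_of_localization hq hsum hTF⟩

theorem PseudoSNumber.IsAdditive.isBigO_gaussianEmbedding (hp : p ≠ ∞) (hqp : q < p)
    {s : PseudoSNumber 𝕜} (hs : s.IsAdditive) {a b : ℝ} (ha : 0 < a) (hb : 0 ≤ b)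
    (hI : (fun n : ℕ => s.num (periodicEmbedding 𝕜 d α p q hqp.le) n)
      =O[atTop] fun n : ℕ => (n : ℝ) ^ (-a) * Real.log n ^ b) :
    (fun n : ℕ => s.num (gaussianEmbedding 𝕜 d α p q hqp.le) n)
      =O[atTop] fun n : ℕ => (n : ℝ) ^ (-a) * Real.log n ^ b := by
  obtain ⟨A, B, C, δ, hC, hδ, hAB, hsum⟩ := exists_gaussianEmbedding_decomposition 𝕜 d α hp hqp
  refine PseudoSNumber.isBigO_num_of_hasSum hs ha hb _ hI hsum
    (w := fun k => C * Real.exp (-δ * ∑ i, (k i : ℝ) ^ 2)) (fun k => by positivity) ?_ ?_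
  -- The power `1/(1+a)` of a Gaussian weight is again Gaussian, with rate `δ/(1+a)`.
  · refine ((summable_exp_neg_mul_sum_sq d (δ := δ / (1 + a)) (by positivity)).mul_left
      (C ^ (1 / (1 + a)))).congr fun k => ?_
    rw [Real.mul_rpow hC.le (by positivity), ← Real.exp_mul]
    congr 2
    ring
  · intro k n hn
    refine (s.num_comp_le (B k) (periodicEmbedding 𝕜 d α p q hqp.le) (A k) n hn).trans ?_
    rw [mul_right_comm]
    exact mul_le_mul_of_nonneg_right (hAB k) (s.num_nonneg _ n hn)

end Upper

end MixedSobolev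

theorem theorem3p1 {𝕜 : Type} [RCLike 𝕜] (d α : ℕ) (hd : 1 ≤ d) (hα : 1 ≤ α)
    (p q : ℝ≥0∞) [Fact (1 ≤ p)] [Fact (1 ≤ q)] (hqp : q < p) (hp : p < ∞)
    (a b : ℝ) (ha : 0 < a) (hb : 0 ≤ b) (s : MixedSobolev.PseudoSNumber 𝕜)
    (hs : (fun n : ℕ => s.num (MixedSobolev.periodicEmbedding 𝕜 d α p q hqp.le) n)
      =Θ[atTop] fun n : ℕ => (n : ℝ) ^ (-a) * Real.log n ^ b) :
    (s.IsWeaklyInjective →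
      (fun n : ℕ => (n : ℝ) ^ (-a) * Real.log n ^ b)
        =O[atTop] fun n : ℕ => s.num (MixedSobolev.gaussianEmbedding 𝕜 d α p q hqp.le) n) ∧
    (s.IsAdditive →
      (fun n : ℕ => s.num (MixedSobolev.gaussianEmbedding 𝕜 d α p q hqp.le) n)
        =O[atTop] fun n : ℕ => (n : ℝ) ^ (-a) * Real.log n ^ b) := by
  refine ⟨fun h => hs.2.trans (h.isBigO_gaussianEmbedding hp.ne (hqp.trans hp).ne hqp.le),
    fun h => h.isBigO_gaussianEmbedding hp.ne hqp ha hb hs.1⟩
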